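/- Let $Y=\{y_k\}_{k\ge1}$, let $Y^*$ be the free monoid on $Y$, and let $\mathbb C\langle\langle Y\rangle\rangle$ be the noncommutative series $S=\sum_{w\in Y^*}\langle S|w\rangle w$. The weight of $w=y_{s_1}\cdots y_{s_k}$ is $s_1+\cdots+s_k$. For $S$ without constant term, $S^*=1+S+S^2+\cdots$ (concatenation powers). The shuffle $\sqcup\!\sqcup$ and the quasi-shuffle $\star$ are the bilinear products on series given on words by $1\star w=w\star 1=w$ and $$y_su\star y_tv=y_s(u\star y_tv)+y_t(y_su\star v)+y_{s+t}(u\star v),$$ the shuffle being given by the same rule without the last term. Infinite products of series, written $\mathop{\star}_{r\ge1}$ and $\mathop{\sqcup\!\sqcup}_{r\ge1}$ respectively, are limits of partial products, each coefficient being eventually constant. For a word $w=y_{s_1}\cdots y_{s_k}$ let $\mathrm H_w(n)=\sum_{n\ge n_1>\cdots>n_k>0}n_1^{-s_1}\cdots n_k^{-s_k}$, and let $\gamma_w$ be the finite part of $\mathrm H_w(n)$ as $n\to\infty$ in the scale $\{n^a\log^bn\}_{a\in\mathbb Z,b\in\mathbb N}$, i.e. the coefficient of $n^0\log^0n$. For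 $S\in\mathbb C\langle\langle Y\rangle\rangle$ let $S_n$ be the part of $S$ of weight $n$. We say $S\in\mathrm{Dom}(\gamma)$ if $\sum_{n\ge0}\gamma_{S_n}$ converges, where $\gamma_{S_n}=\sum_{w\text{ of weight }n}\langle S|w\rangle\gamma_w$, and then $\gamma_S:=\sum_{n\ge0}\gamma_{S_n}$. For $|z|<1$ put $\ell_1(z)=\gamma z-\sum_{k\ge2}\zeta(k)\frac{(-z)^k}{k}$ ($\gamma$ being Euler's constant), $\ell_r(z)=-\sum_{k\ge1}\zeta(kr)\frac{(-z^r)^k}{k}$ for $r\ge2$, and $\Gamma_{y_r}(1+z)=e^{-\ell_r(z)}$ for $r\ge1$. With the differential forms $\omega_r=(\partial\ell_r)\,dz$ on the unit disc, let $\alpha_0^z(y_{s_1}\cdots y_{s_k})=\int_0^z\omega_{s_1}(z_1)\int_0^{z_1}\omega_{s_2}(z_2)\cdots\int_0^{z_{k-1}}\omega_{s_k}(z_k)$ and $\alpha_0^z(S)=\sum_{w}\langle S|w\rangle\alpha_0^z(w)$ when this series converges absolutely. The finite part $\gamma_w$ exists for every word $w$, and the following holds. 1. Let $|z|<1$. The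 infinite products of series $\mathop{\star}\limits_{r\ge1}(z^ry_r)^*$ and $\mathop{\sqcup\!\sqcup}\limits_{r\ge1}y_r^*$ exist, the series $(z^ry_r)^*$ $(r\ge1)$ and $\mathop{\star}\limits_{r\ge1}(z^ry_r)^*$ belong to $\mathrm{Dom}(\gamma)$, the infinite products of numbers and the series $\alpha_0^z$ below converge unconditionally, and $$\gamma_{\mathop{\star}\limits_{r\ge1}(z^ry_r)^*}=\prod_{r\ge1}\gamma_{(z^ry_r)^*}=\prod_{r\ge1}e^{\ell_r(z)}=\prod_{r\ge1}\frac1{\Gamma_{y_r}(1+z)}=\alpha_0^z\Bigl(\mathop{\sqcup\!\sqcup}\limits_{r\ge1}\,y_r^*\Bigr).$$ 2. Let $(a_s)_{s\ge1},(b_s)_{s\ge1}$ be sequences of complex numbers. Then $$\gamma_{(\sum_{s\ge1}(a_s+b_s)y_s+\sum_{r,s\ge1}a_sb_ry_{s+r})^*}=\gamma_{(\sum_{s\ge1}a_sy_s)^*}\,\gamma_{(\sum_{s\ge1}b_sy_s)^*}$$ whenever the three series occurring in it belong to $\mathrm{Dom}(\gamma)$; and they do belong to $\mathrm{Dom}(\gamma)$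 if $\sum_s|a_s|<\infty$ and $\sum_s|b_s|<\infty$. In particular, for all $r,s\ge1$ and $c,d\in\mathbb C$, all series below belong to $\mathrm{Dom}(\gamma)$ and $$\gamma_{(c\,y_s+d\,y_r+cd\,y_{s+r})^*}=\gamma_{(c\,y_s)^*}\gamma_{(d\,y_r)^*},\qquad \gamma_{(-c^2y_{2s})^*}=\gamma_{(c\,y_s)^*}\gamma_{(-c\,y_s)^*}.$$ -/

import Mathlib

open Filter Topology

noncomputable section

namespace EulerianStars

/-- Words over the alphabet `Y = {y_k : k ≥ 1}`; the letter `y_k` is the positive integer `k`. -/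
abbrev Word : Type := List ℕ+

/-- Noncommutative formal power series over `Y` with complex coefficients:
`S w` is the coefficient of the word `w` in `S`. Sums and scalar multiples are coefficientwise;
the (pointwise) multiplication of functions is never used. -/
abbrev Series : Type := Word → ℂ

/-- The weight `s₁ + ⋯ + s_k` of the word `y_{s₁} ⋯ y_{s_k}`. -/
def weight (w : Word) : ℕ := (w.map PNat.val).sum

theorem finite_weight_eq (n : ℕ) : {w : Word | weight w = n}.Finite := by
  have hinj : Function.Injective (List.map PNat.val) :=
    List.map_injective_iff.mpr PNat.coe_injective
  refine Set.Finite.of_finite_image (f := List.map PNat.val) ?_ hinj.injOn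
  refine (Set.finite_range (fun c : Composition n => c.blocks)).subset ?_
  rintro _ ⟨w, hw, rfl⟩
  refine ⟨⟨w.map PNat.val, ?_, hw⟩, rfl⟩
  intro i hi
  obtain ⟨s, -, rfl⟩ := List.mem_map.mp hi
  exact s.pos

/-- The finite set of words of weight `n`. -/
def wordsOfWeight (n : ℕ) : Finset Word := (finite_weight_eq n).toFinset

/-! ### Concatenation, Kleene star -/

/-- The series `1`, that is, the empty word. -/
def oneSeries : Series := fun w => if w = [] then 1 else 0

/-- The concatenation (Cauchy) product: the sum over all factorizations `w = u v`. -/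
def conc (S T : Series) : Series := fun w =>
  ∑ i ∈ Finset.range (w.length + 1), S (w.take i) * T (w.drop i)

/-- Powers for the concatenation product. -/
def concPow (S : Series) : ℕ → Series
  | 0 => oneSeries
  | n + 1 => conc S (concPow S n)

/-- The Kleene star `S^* = 1 + S + S² + ⋯` of a series without constant term; for such a series
`S^n` has no word of length less than `n`, so that the sum stops at the length of the word. -/
def kleeneStar (S : Series) : Series := fun w =>
  ∑ n ∈ Finset.range (w.length + 1), concPow S n w

/-- The homogeneous series of degree one `∑_{s ≥ 1} a_s y_s`. -/
def letters (a : ℕ+ → ℂ) : Series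
  | [s] => a s
  | _ => 0

/-! ### Shuffle and quasi-shuffle products -/

/-- The words of the shuffle product of two words, listed with multiplicity. -/
def shuffleWords : Word → Word → List Word
  | [], v => [v]
  | a :: u, [] => [a :: u]
  | a :: u, b :: v =>
      (shuffleWords u (b :: v)).map (List.cons a) ++
      (shuffleWords (a :: u) v).map (List.cons b)
termination_by u v => u.length + v.length

/-- The words of the quasi-shuffle product of two words, listed with multiplicity. -/
def stuffleWords : Word → Word → List Word
  | [], v => [v]
  | a :: u, [] => [a :: u]
  | a :: u, b :: v =>
      (stuffleWords u (b :: v)).map (List.cons a) ++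
      (stuffleWords (a :: u) v).map (List.cons b) ++
      (stuffleWords u v).map (List.cons (a + b))
termination_by u v => u.length + v.length

/-- Bilinear extension to series of a product of words that preserves the weight. -/
def extendProduct (m : Word → Word → List Word) (S T : Series) : Series := fun w =>
  ∑ p ∈ Finset.HasAntidiagonal.antidiagonal (weight w), ∑ u ∈ wordsOfWeight p.1, ∑ v ∈ wordsOfWeight p.2,
    S u * T v * ((m u v).count w : ℂ)

/-- The shuffle product of two series. -/
def shuffle : Series → Series → Series := extendProduct shuffleWords

/-- The quasi-shuffle product of two series. -/
def stuffle : Series → Series → Series := extendProduct stuffleWords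

/-- The partial product `F 1 ⋆ F 2 ⋆ ⋯ ⋆ F k` for a product `⋆` of series. -/
def partialProduct (op : Series → Series → Series) (F : ℕ+ → Series) : ℕ → Series
  | 0 => oneSeries
  | k + 1 => op (partialProduct op F k) (F k.succPNat)

/-- `S` is the infinite product of the `F r`, `r ≥ 1`: every coefficient of the partial products
is eventually equal to that of `S`. -/
def IsInfiniteProduct (op : Series → Series → Series) (F : ℕ+ → Series) (S : Series) : Prop :=
  ∀ w : Word, ∀ᶠ k in atTop, partialProduct op F k w = S w

/-! ### Harmonic sums and the character `γ` -/

/-- The harmonic sum `H_{s₁,…,s_r}(n) = ∑_{n ≥ n₁ > ⋯ > n_r > 0} n₁^{-s₁} ⋯ n_r^{-s_r}`,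
summed first over `n₁ = m + 1`. -/
def harmonicSum : Word → ℕ → ℂ
  | [], _ => 1
  | s :: w, n => ∑ m ∈ Finset.range n, harmonicSum w m / ((m : ℂ) + 1) ^ (s : ℕ)

/-- `c` is the finite part of `f n` as `n → ∞` in the scale `n^a (log n)^b`, `a ∈ ℤ`, `b ∈ ℕ`:
up to a null sequence, `f` is a finite combination of functions of the scale, and `c` is the
coefficient of `n^0 (log n)^0`. -/
def HasFinitePart (f : ℕ → ℂ) (c : ℂ) : Prop :=
  ∃ C : (ℤ × ℕ) →₀ ℂ, C (0, 0) = c ∧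
    Tendsto (fun n : ℕ => f n -
      C.sum fun p k => k * ((n : ℂ) ^ p.1 * ((Real.log (n : ℝ) : ℝ) : ℂ) ^ p.2)) atTop (𝓝 0)

/-- `γ_w`, the finite part of the harmonic sum `H_w(n)`. -/
def gammaWord (w : Word) : ℂ := Classical.epsilon (HasFinitePart (harmonicSum w))

/-- The value of `γ` at the (polynomial) homogeneous component of weight `n` of `S`. -/
def gammaComponent (S : Series) (n : ℕ) : ℂ := ∑ w ∈ wordsOfWeight n, S w * gammaWord w

/-- The domain of `γ`: the series `S = ∑ₙ Sₙ`, `Sₙ` of weight `n`, for which `∑ₙ γ_{Sₙ}`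
converges. -/
def gammaDom : Set Series :=
  {S | ∃ c : ℂ, Tendsto (fun N => ∑ n ∈ Finset.range N, gammaComponent S n) atTop (𝓝 c)}

/-- `γ_S = ∑ₙ γ_{Sₙ}`, for `S` in the domain of `γ`. -/
def gammaSeries (S : Series) : ℂ :=
  limUnder atTop (fun N => ∑ n ∈ Finset.range N, gammaComponent S n)

/-! ### The functions `ℓ_r`, `Γ_{y_r}`, and iterated integrals -/

/-- `ℓ_1(z) = γ z - ∑_{k ≥ 2} ζ(k) (-z)^k / k` and
`ℓ_r(z) = -∑_{k ≥ 1} ζ(k r) (-z^r)^k / k` for `r ≥ 2` (where `|z| < 1`). -/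
def ell (r : ℕ+) (z : ℂ) : ℂ :=
  if r = 1 then
    (Real.eulerMascheroniConstant : ℂ) * z
      - ∑' k : ℕ, riemannZeta ((k : ℂ) + 2) * (-z) ^ (k + 2) / ((k : ℂ) + 2)
  else
    -∑' k : ℕ, riemannZeta (((k : ℂ) + 1) * ((r : ℕ) : ℂ)) * (-z ^ (r : ℕ)) ^ (k + 1)
      / ((k : ℂ) + 1)

/-- `Γ_{y_r}`, defined on the disc of centre `1` and radius `1` by
`Γ_{y_r}(1 + z) = exp (-ℓ_r(z))`. -/
def GammaY (r : ℕ+) (u : ℂ) : ℂ := Complex.exp (-ell r (u - 1))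

/-- The iterated integral `∫_0^z ω_{s₁}(z₁) ∫_0^{z₁} ω_{s₂}(z₂) ⋯` of the differential forms
`ω_s = (∂ℓ_s) dz` for the word `y_{s₁} y_{s₂} ⋯`, where `|z| < 1`. The forms are holomorphic on
the unit disc, so the path does not matter, and each integral is taken along a segment. -/
def alphaWord : Word → ℂ → ℂ
  | [], _ => 1
  | s :: w, z => ∫ t in (0 : ℝ)..1,
      deriv (ell s) ((t : ℂ) * z) * alphaWord w ((t : ℂ) * z) * z

/-- The coefficients of `∑_s (a_s + b_s) y_s + ∑_{r,s} a_s b_r y_{s+r}`. -/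
def starLaw (a b : ℕ+ → ℂ) : ℕ+ → ℂ := fun n =>
  a n + b n + ∑ p ∈ (Finset.Iio n ×ˢ Finset.Iio n).filter (fun p => p.1 + p.2 = n), a p.1 * b p.2

end EulerianStars

end

open EulerianStars

/-!
The coefficients of a star `(∑ a_s y_s)^*` are multiplicative along a word. Hence the harmonic
sums `H_w(n)`, weighted by these coefficients and collected by weight, have the finite product
`∏_{m ≤ n} (1 + ∑_s a_s X^s / m^s)` as generating series, and `starLaw` is the effect on the
coefficients of multiplying two such factors. Each `H_w(n)` is a polynomial in `log n` up to an
error of power decay, and `γ_w` is the constant term of that polynomial. Taking constant terms is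
multiplicative, so the generating series of `γ` on stars is multiplicative too, and Abel's theorem
evaluates it at `X = 1`.

When `∑ |a_s| < ∞`, the factors `exp (-a_1 X / m)` compensate the only divergence of the product,
that of the harmonic series. The sums of the absolute values of the coefficients of the compensated
products are bounded uniformly in `n`, so `γ` converges absolutely on the star. For a single letter,
expanding the logarithm of the product gives the value `e^{ℓ_r}`. In the infinite quasi-shuffle
product, replacing `z` by a slightly larger argument gives a bound uniform in the partial products,
each of whose coefficients stabilizes; dominated convergence then gives the value `∏_r e^{ℓ_r(z)}`.

On the side of iterated integrals, the sum over all words of length `k` is `(∑_r ℓ_r(z))^k / k!`,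
as for any one-form on a path, and these sum up to the same exponential.
-/

noncomputable section

namespace EulerianStars

@[simp] theorem weight_nil : weight [] = 0 := rfl

@[simp] theorem weight_cons (s : ℕ+) (w : Word) : weight (s :: w) = (s : ℕ) + weight w := rfl

@[simp] theorem mem_wordsOfWeight {n : ℕ} {w : Word} : w ∈ wordsOfWeight n ↔ weight w = n := by
  simp [wordsOfWeight]

theorem weight_eq_zero_iff {w : Word} : weight w = 0 ↔ w = [] := by
  cases w <;> simp

theorem wordsOfWeight_zero : wordsOfWeight 0 = {[]} := by
  ext w
  simp [weight_eq_zero_iff]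

/-! ### Kleene stars of homogeneous series of degree one -/

theorem conc_letters_nil (a : ℕ+ → ℂ) (T : Series) : conc (letters a) T [] = 0 := by
  simp [conc, letters]

theorem conc_letters_cons (a : ℕ+ → ℂ) (T : Series) (s : ℕ+) (w : Word) :
    conc (letters a) T (s :: w) = a s * T w := by
  rw [conc, Finset.sum_eq_single 1]
  · simp [letters]
  · intro i hi h1
    match i, w with
    | 0, _ => simp [letters]
    | 1, _ => exact absurd rfl h1
    | i + 2, [] => simp at hi
    | i + 2, t :: w => simp [letters]
  · simp

theorem concPow_letters (a : ℕ+ → ℂ) (n : ℕ) (w : Word) :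
    concPow (letters a) n w = if w.length = n then (w.map a).prod else 0 := by
  induction n generalizing w with
  | zero => cases w <;> simp [concPow, oneSeries]
  | succ n ih =>
    cases w with
    | nil => simp [concPow, conc_letters_nil]
    | cons s w => simp [concPow, conc_letters_cons, ih]

theorem kleeneStar_letters (a : ℕ+ → ℂ) (w : Word) :
    kleeneStar (letters a) w = (w.map a).prod := by
  simp [kleeneStar, concPow_letters]

theorem kleeneStar_letters_nil (a : ℕ+ → ℂ) : kleeneStar (letters a) [] = 1 := by
  simp [kleeneStar_letters]

theorem kleeneStar_letters_cons (a : ℕ+ → ℂ) (s : ℕ+) (w : Word) :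
    kleeneStar (letters a) (s :: w) = a s * kleeneStar (letters a) w := by
  simp [kleeneStar_letters]

theorem kleeneStar_letters_zero : kleeneStar (letters 0) = oneSeries := by
  funext w
  cases w <;> simp [kleeneStar_letters, oneSeries]

theorem eq_kleeneStar_letters {S : Series} {a : ℕ+ → ℂ} (h_nil : S [] = 1)
    (h_cons : ∀ s w, S (s :: w) = a s * S w) : S = kleeneStar (letters a) := by
  funext w
  induction w with
  | nil => rw [h_nil, kleeneStar_letters_nil]
  | cons s w ih => rw [h_cons, kleeneStar_letters_cons, ih]

theorem kleeneStar_letters_congr {a b : ℕ+ → ℂ} {w : Word}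
    (h : ∀ s : ℕ+, (s : ℕ) ≤ weight w → a s = b s) :
    kleeneStar (letters a) w = kleeneStar (letters b) w := by
  induction w with
  | nil => simp only [kleeneStar_letters_nil]
  | cons s w ih =>
    rw [kleeneStar_letters_cons, kleeneStar_letters_cons, h s (by simp),
      ih fun t ht => h t (ht.trans (by simp))]

/-! ### Left derivatives of products of series -/

/-- A product of words is graded if all the words of `m u v` have weight
`weight u + weight v`; then its bilinear extension to series is a sum over all pairs of words. -/
def IsGraded (m : Word → Word → List Word) : Prop :=
  ∀ u v, ∀ w ∈ m u v, weight w = weight u + weight v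

theorem isGraded_shuffleWords : IsGraded shuffleWords := by
  intro u v
  induction u, v using shuffleWords.induct with
  | case1 v => simp [shuffleWords]
  | case2 a u => simp [shuffleWords]
  | case3 a u b v ih_left ih_right =>
    rw [shuffleWords]
    intro w hw
    simp only [List.mem_append, List.mem_map] at hw
    obtain ⟨x, hx, rfl⟩ | ⟨x, hx, rfl⟩ := hw
    · simp only [weight_cons, ih_left x hx, add_assoc]
    · simp only [weight_cons, ih_right x hx, add_left_comm]

theorem isGraded_stuffleWords : IsGraded stuffleWords := by
  intro u v
  induction u, v using stuffleWords.induct with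
  | case1 v => simp [stuffleWords]
  | case2 a u => simp [stuffleWords]
  | case3 a u b v ih_left ih_right ih_merge =>
    rw [stuffleWords]
    intro w hw
    simp only [List.mem_append, List.mem_map] at hw
    obtain (⟨x, hx, rfl⟩ | ⟨x, hx, rfl⟩) | ⟨x, hx, rfl⟩ := hw
    · simp only [weight_cons, ih_left x hx, add_assoc]
    · simp only [weight_cons, ih_right x hx, add_left_comm]
    · simp only [weight_cons, PNat.add_coe, ih_merge x hx, add_add_add_comm]

theorem hasSum_extendProduct {m : Word → Word → List Word} (hm : IsGraded m) (S T : Series)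
    (w : Word) :
    HasSum (fun p : Word × Word => S p.1 * T p.2 * ((m p.1 p.2).count w : ℂ))
      (extendProduct m S T w) := by
  have hdisj : ((Finset.HasAntidiagonal.antidiagonal (weight w) : Finset (ℕ × ℕ)) :
      Set (ℕ × ℕ)).PairwiseDisjoint fun p => wordsOfWeight p.1 ×ˢ wordsOfWeight p.2 := by
    intro p _ q _ hpq
    refine Finset.disjoint_left.2 fun x hxp hxq => hpq ?_
    simp only [Finset.mem_product, mem_wordsOfWeight] at hxp hxq
    exact Prod.ext (hxp.1.symm.trans hxq.1) (hxp.2.symm.trans hxq.2)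
  have hsum : extendProduct m S T w =
      ∑ p ∈ (Finset.HasAntidiagonal.antidiagonal (weight w)).biUnion
        fun p => wordsOfWeight p.1 ×ˢ wordsOfWeight p.2,
        S p.1 * T p.2 * ((m p.1 p.2).count w : ℂ) := by
    rw [Finset.sum_biUnion hdisj]
    simp only [extendProduct, Finset.sum_product]
  rw [hsum]
  refine hasSum_sum_of_ne_finset_zero fun p hp => ?_
  have hw : w ∉ m p.1 p.2 := fun hw => hp <| by
    simp only [Finset.mem_biUnion, Finset.mem_product, mem_wordsOfWeight]
    exact ⟨(weight p.1, weight p.2),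
      Finset.HasAntidiagonal.mem_antidiagonal.2 (hm _ _ w hw).symm, rfl, rfl⟩
  rw [List.count_eq_zero.2 hw, Nat.cast_zero, mul_zero]

theorem extendProduct_nil {m : Word → Word → List Word} (hm : m [] [] = [[]]) (S T : Series) :
    extendProduct m S T [] = S [] * T [] := by
  simp [extendProduct, wordsOfWeight_zero, hm]

theorem extendProduct_mul_left (m : Word → Word → List Word) (x : ℂ) (S T : Series) (w : Word) :
    extendProduct m (fun u => x * S u) T w = x * extendProduct m S T w := by
  simp only [extendProduct, Finset.mul_sum, mul_assoc]

theorem extendProduct_mul_right (m : Word → Word → List Word) (x : ℂ) (S T : Series) (w : Word) :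
    extendProduct m S (fun v => x * T v) w = x * extendProduct m S T w := by
  simp only [extendProduct, Finset.mul_sum, mul_assoc, mul_left_comm x]

/-- The function on words that vanishes off `c Y^*` and maps `c u` to `f u`. It transposes the
left derivative `S ↦ (u ↦ S (c :: u))` and so expresses the recursion of a product of words. -/
def extendCons (c : ℕ+) (f : Word → ℕ) : Word → ℕ
  | [] => 0
  | a :: u => if a = c then f u else 0

theorem count_map_cons (a c : ℕ+) (l : List Word) (w : Word) :
    (l.map (List.cons a)).count (c :: w) = if a = c then l.count w else 0 := by
  split_ifs with h
  · subst h
    exact List.count_map_of_injective l (List.cons a) List.cons_injective w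
  · simp [List.count_eq_zero, h]

theorem shuffleWords_nil_right (u : Word) : shuffleWords u [] = [u] := by
  cases u <;> simp [shuffleWords]

theorem stuffleWords_nil_right (u : Word) : stuffleWords u [] = [u] := by
  cases u <;> simp [stuffleWords]

theorem extendCons_count_singleton (c : ℕ+) (w u : Word) :
    extendCons c (fun x => [x].count w) u = [u].count (c :: w) := by
  cases u with
  | nil => simp [extendCons]
  | cons a u => by_cases h : a = c <;> simp [extendCons, List.count_singleton, h]

theorem count_shuffleWords_cons (c : ℕ+) (w u v : Word) :
    (shuffleWords u v).count (c :: w) =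
      extendCons c (fun x => (shuffleWords x v).count w) u +
        extendCons c (fun y => (shuffleWords u y).count w) v := by
  match u, v with
  | [], v => simp [shuffleWords, extendCons_count_singleton, extendCons.eq_1]
  | a :: u, [] => simp [shuffleWords_nil_right, extendCons_count_singleton, extendCons.eq_1]
  | a :: u, b :: v =>
    rw [shuffleWords, List.count_append, count_map_cons, count_map_cons]
    rfl

/-- The decompositions of a letter index as a sum, as they occur in `starLaw`. -/
abbrev splittings (c : ℕ+) : Finset (ℕ+ × ℕ+) :=
  (Finset.Iio c ×ˢ Finset.Iio c).filter fun q => q.1 + q.2 = c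

theorem mem_splittings {c : ℕ+} {q : ℕ+ × ℕ+} : q ∈ splittings c ↔ q.1 + q.2 = c := by
  simp only [splittings, Finset.mem_filter, Finset.mem_product, Finset.mem_Iio,
    and_iff_right_iff_imp]
  rintro rfl
  exact ⟨PNat.lt_add_right q.1 q.2, PNat.lt_add_left q.2 q.1⟩

theorem sum_splittings_extendCons (c a b : ℕ+) (f : Word → Word → ℕ) (u v : Word) :
    ∑ q ∈ splittings c, extendCons q.1 (fun x => extendCons q.2 (f x) (b :: v)) (a :: u) =
      if a + b = c then f u v else 0 := by
  have hterm (q : ℕ+ × ℕ+) :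
      extendCons q.1 (fun x => extendCons q.2 (f x) (b :: v)) (a :: u) =
        if (a, b) = q then f u v else 0 := by
    simp only [extendCons, Prod.ext_iff, ite_and]
  simp only [hterm, Finset.sum_ite_eq, mem_splittings]

theorem count_stuffleWords_cons (c : ℕ+) (w u v : Word) :
    (stuffleWords u v).count (c :: w) =
      extendCons c (fun x => (stuffleWords x v).count w) u +
        extendCons c (fun y => (stuffleWords u y).count w) v +
        ∑ q ∈ splittings c,
          extendCons q.1 (fun x => extendCons q.2 (fun y => (stuffleWords x y).count w) v) u := by
  match u, v with
  | [], v => simp [stuffleWords, extendCons_count_singleton, extendCons.eq_1]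
  | a :: u, [] =>
    have hzero (q : ℕ+ × ℕ+) : extendCons q.1 (fun _ => 0) (a :: u) = 0 := by simp [extendCons]
    simp [stuffleWords_nil_right, extendCons_count_singleton, extendCons.eq_1, hzero]
  | a :: u, b :: v =>
    rw [sum_splittings_extendCons, stuffleWords, List.count_append, List.count_append,
      count_map_cons, count_map_cons, count_map_cons]
    rfl

theorem hasSum_extendCons_left (S T : Series) (f : Word → Word → ℕ) {c : ℕ+} {x : ℂ}
    (h : HasSum (fun p : Word × Word => S (c :: p.1) * T p.2 * (f p.1 p.2 : ℂ)) x) :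
    HasSum (fun p : Word × Word =>
      S p.1 * T p.2 * (extendCons c (fun u => f u p.2) p.1 : ℂ)) x := by
  have hinj : Function.Injective fun p : Word × Word => (c :: p.1, p.2) :=
    List.cons_injective.prodMap Function.injective_id
  rw [← hinj.hasSum_iff]
  · simpa [Function.comp_def, extendCons] using h
  · rintro ⟨_ | ⟨a, u⟩, v⟩ hp
    · simp [extendCons]
    · have hac : a ≠ c := by
        rintro rfl
        exact hp ⟨(u, v), rfl⟩
      simp [extendCons, hac]

theorem hasSum_extendCons_right (S T : Series) (f : Word → Word → ℕ) {c : ℕ+} {x : ℂ}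
    (h : HasSum (fun p : Word × Word => S p.1 * T (c :: p.2) * (f p.1 p.2 : ℂ)) x) :
    HasSum (fun p : Word × Word => S p.1 * T p.2 * (extendCons c (f p.1) p.2 : ℂ)) x := by
  rw [← (Equiv.prodComm Word Word).hasSum_iff] at h ⊢
  simp only [Function.comp_def, Equiv.prodComm_apply, Prod.fst_swap, Prod.snd_swap,
    mul_comm (S _)] at h ⊢
  exact hasSum_extendCons_left T S (fun v u => f u v) h

theorem shuffle_cons (S T : Series) (c : ℕ+) (w : Word) :
    shuffle S T (c :: w) =
      shuffle (fun u => S (c :: u)) T w + shuffle S (fun v => T (c :: v)) w := by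
  let f (u v : Word) : ℕ := (shuffleWords u v).count w
  have hleft := hasSum_extendCons_left S T f
    (hasSum_extendProduct isGraded_shuffleWords (fun u => S (c :: u)) T w)
  have hright := hasSum_extendCons_right S T f
    (hasSum_extendProduct isGraded_shuffleWords S (fun v => T (c :: v)) w)
  refine (hasSum_extendProduct isGraded_shuffleWords S T (c :: w)).unique ?_
  simp only [shuffle]
  convert hleft.add hright using 2 with p
  rw [count_shuffleWords_cons, Nat.cast_add, mul_add]

theorem stuffle_cons (S T : Series) (c : ℕ+) (w : Word) :
    stuffle S T (c :: w) =
      stuffle (fun u => S (c :: u)) T w + stuffle S (fun v => T (c :: v)) w +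
      ∑ q ∈ splittings c, stuffle (fun u => S (q.1 :: u)) (fun v => T (q.2 :: v)) w := by
  let f (u v : Word) : ℕ := (stuffleWords u v).count w
  have hleft := hasSum_extendCons_left S T f
    (hasSum_extendProduct isGraded_stuffleWords (fun u => S (c :: u)) T w)
  have hright := hasSum_extendCons_right S T f
    (hasSum_extendProduct isGraded_stuffleWords S (fun v => T (c :: v)) w)
  have hmerge := hasSum_sum fun q (_ : q ∈ splittings c) =>
    hasSum_extendCons_left S T (fun u v => extendCons q.2 (f u) v) <|
      hasSum_extendCons_right (fun u => S (q.1 :: u)) T f <|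
        hasSum_extendProduct isGraded_stuffleWords (fun u => S (q.1 :: u))
          (fun v => T (q.2 :: v)) w
  refine (hasSum_extendProduct isGraded_stuffleWords S T (c :: w)).unique ?_
  simp only [stuffle]
  convert (hleft.add hright).add hmerge using 2 with p
  rw [count_stuffleWords_cons, Nat.cast_add, Nat.cast_add, Nat.cast_sum, mul_add, mul_add,
    Finset.mul_sum]

theorem shuffle_kleeneStar (a b : ℕ+ → ℂ) :
    shuffle (kleeneStar (letters a)) (kleeneStar (letters b)) = kleeneStar (letters (a + b)) := by
  apply eq_kleeneStar_letters
  · rw [shuffle, extendProduct_nil (by simp [shuffleWords]), kleeneStar_letters_nil,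
      kleeneStar_letters_nil, mul_one]
  · intro s w
    rw [shuffle_cons]
    simp only [kleeneStar_letters_cons, shuffle, extendProduct_mul_left, extendProduct_mul_right,
      Pi.add_apply, add_mul]

theorem stuffle_kleeneStar (a b : ℕ+ → ℂ) :
    stuffle (kleeneStar (letters a)) (kleeneStar (letters b)) =
      kleeneStar (letters (starLaw a b)) := by
  apply eq_kleeneStar_letters
  · rw [stuffle, extendProduct_nil (by simp [stuffleWords]), kleeneStar_letters_nil,
      kleeneStar_letters_nil, mul_one]
  · intro s w
    rw [stuffle_cons]
    simp only [kleeneStar_letters_cons, stuffle, extendProduct_mul_left, extendProduct_mul_right,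
      starLaw, add_mul, Finset.sum_mul, mul_assoc, mul_left_comm (a _) (b _)]

/-! ### Infinite products of stars -/

theorem partialProduct_shuffle_kleeneStar (c : ℕ+ → ℂ) (k : ℕ) :
    partialProduct shuffle (fun r => kleeneStar (letters (Pi.single r (c r)))) k =
      kleeneStar (letters fun s => if (s : ℕ) ≤ k then c s else 0) := by
  induction k with
  | zero =>
    have hzero : (fun s : ℕ+ => if (s : ℕ) ≤ 0 then c s else 0) = 0 := by
      funext s
      simp
    rw [hzero, kleeneStar_letters_zero, partialProduct]
  | succ k ih =>
    rw [partialProduct, ih, shuffle_kleeneStar]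
    congr 2
    funext s
    by_cases h : s = k.succPNat
    · simp [h]
    · have hne : (s : ℕ) ≠ k + 1 := fun e => h (PNat.coe_injective e)
      simp [h, hne, Nat.le_succ_iff]

theorem isInfiniteProduct_shuffle_kleeneStar (c : ℕ+ → ℂ) :
    IsInfiniteProduct shuffle (fun r => kleeneStar (letters (Pi.single r (c r))))
      (kleeneStar (letters c)) := by
  intro w
  filter_upwards [eventually_ge_atTop (weight w)] with k hk
  rw [partialProduct_shuffle_kleeneStar]
  exact kleeneStar_letters_congr fun s hs => if_pos (hs.trans hk)

/-- The coefficients of `x^s`, `s ≥ 1`, in the partial products `∏_{r ≤ k} (1 + c_r x^r)`; the star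
with these coefficients is the quasi-shuffle product of the stars of the `c_r y_r`, `r ≤ k`. -/
def starLawProd (c : ℕ+ → ℂ) : ℕ → ℕ+ → ℂ
  | 0 => 0
  | k + 1 => starLaw (starLawProd c k) (Pi.single k.succPNat (c k.succPNat))

theorem partialProduct_stuffle_kleeneStar (c : ℕ+ → ℂ) (k : ℕ) :
    partialProduct stuffle (fun r => kleeneStar (letters (Pi.single r (c r)))) k =
      kleeneStar (letters (starLawProd c k)) := by
  induction k with
  | zero => rw [starLawProd, kleeneStar_letters_zero, partialProduct]
  | succ k ih => rw [partialProduct, ih, stuffle_kleeneStar, starLawProd]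

theorem starLaw_single_apply_of_lt (a : ℕ+ → ℂ) (c : ℂ) {r s : ℕ+} (h : s < r) :
    starLaw a (Pi.single r c) s = a s := by
  rw [starLaw, Pi.single_eq_of_ne h.ne, Finset.sum_eq_zero, add_zero, add_zero]
  intro q hq
  have hq2 : q.2 < s := (Finset.mem_Iio.1 (Finset.mem_product.1 (Finset.mem_filter.1 hq).1).2)
  rw [Pi.single_eq_of_ne (hq2.trans h).ne, mul_zero]

theorem starLawProd_apply_of_le (c : ℕ+ → ℂ) (s : ℕ+) {k : ℕ} (hk : (s : ℕ) ≤ k) :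
    starLawProd c k s = starLawProd c s s := by
  induction k, hk using Nat.le_induction with
  | base => rfl
  | succ k hk ih =>
    rw [starLawProd, starLaw_single_apply_of_lt _ _ (Nat.lt_succ_of_le hk), ih]

/-- The coefficients of `x^s`, `s ≥ 1`, in the infinite product `∏_r (1 + c_r x^r)`. -/
def starLawLim (c : ℕ+ → ℂ) (s : ℕ+) : ℂ := starLawProd c s s

theorem isInfiniteProduct_stuffle_kleeneStar (c : ℕ+ → ℂ) :
    IsInfiniteProduct stuffle (fun r => kleeneStar (letters (Pi.single r (c r))))
      (kleeneStar (letters (starLawLim c))) := by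
  intro w
  filter_upwards [eventually_ge_atTop (weight w)] with k hk
  rw [partialProduct_stuffle_kleeneStar]
  exact kleeneStar_letters_congr fun s hs => starLawProd_apply_of_le c s (hs.trans hk)

/-! ### Sequences of power decay -/

/-- `e n = O(n^{-δ})` for some `δ > 0`. Unlike mere convergence to `0`, this is preserved by
multiplication by `log n` and, up to an additive constant, by summation against `1 / (m + 1)`. -/
def PowerDecay (e : ℕ → ℂ) : Prop :=
  ∃ δ > (0 : ℝ), e =O[atTop] fun n : ℕ => (n : ℝ) ^ (-δ)

/-- The sequence `log n`. -/
def logSeq (n : ℕ) : ℂ := ((Real.log (n : ℝ) : ℝ) : ℂ)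

theorem norm_logSeq (n : ℕ) : ‖logSeq n‖ = Real.log n := by
  rw [logSeq, Complex.norm_real, Real.norm_of_nonneg (Real.log_natCast_nonneg n)]

theorem tendsto_log_natCast_atTop : Tendsto (fun n : ℕ => Real.log (n : ℝ)) atTop atTop :=
  Real.tendsto_log_atTop.comp tendsto_natCast_atTop_atTop

theorem norm_natCast_add_one (n : ℕ) : ‖(n : ℂ) + 1‖ = (n : ℝ) + 1 := by
  exact_mod_cast Complex.norm_natCast (n + 1)

theorem natCast_rpow_isBigO_rpow {a b : ℝ} (h : a ≤ b) :
    (fun n : ℕ => (n : ℝ) ^ a) =O[atTop] fun n : ℕ => (n : ℝ) ^ b := by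
  refine .of_norm_eventuallyLE ?_
  filter_upwards [eventually_ge_atTop 1] with n hn
  rw [Real.norm_of_nonneg (by positivity)]
  exact Real.rpow_le_rpow_of_exponent_le (by exact_mod_cast hn) h

theorem isBigO_sum_range_sub_tsum {E : Type*} [NormedAddCommGroup E] [CompleteSpace E]
    {f : ℕ → E} {η : ℝ} (hη : 0 < η) (hf : f =O[atTop] fun n : ℕ => (n : ℝ) ^ (-η + (-1 - η))) :
    (fun N => ∑ m ∈ Finset.range N, f m - ∑' m, f m) =O[atTop] fun n : ℕ => (n : ℝ) ^ (-η) := by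
  have hsum : Summable f :=
    summable_of_isBigO_nat (Real.summable_nat_rpow.2 (by linarith)) hf
  have hmajorant : Summable fun m : ℕ => ((m : ℝ) + 1) ^ (-1 - η) := by
    have hrpow := Real.summable_nat_rpow.2 (by linarith : -1 - η < -1)
    exact_mod_cast (summable_nat_add_iff 1).2 hrpow
  obtain ⟨C, hC_nonneg, hC⟩ := hf.exists_nonneg
  obtain ⟨N₀, hN₀⟩ := eventually_atTop.1 hC.bound
  refine .of_bound (C * ∑' m : ℕ, ((m : ℝ) + 1) ^ (-1 - η)) ?_
  filter_upwards [eventually_ge_atTop N₀, eventually_ge_atTop 1] with N hN hN_pos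
  have hN_real : (1 : ℝ) ≤ N := by exact_mod_cast hN_pos
  have hterm (m : ℕ) : ‖f (m + N)‖ ≤ C * (N : ℝ) ^ (-η) * ((m : ℝ) + 1) ^ (-1 - η) := by
    refine (hN₀ (m + N) (by omega)).trans ?_
    rw [Nat.cast_add, Real.norm_of_nonneg (by positivity), Real.rpow_add (by positivity), mul_assoc]
    gcongr ?_ * (?_ * ?_)
    · exact Real.rpow_le_rpow_of_nonpos (by positivity) (by simp) (by linarith)
    · exact Real.rpow_le_rpow_of_nonpos (by positivity) (by linarith) (by linarith)
  calc ‖∑ m ∈ Finset.range N, f m - ∑' m, f m‖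
      = ‖∑' m, f (m + N)‖ := by
        rw [← hsum.sum_add_tsum_nat_add N, sub_add_cancel_left, norm_neg]
    _ ≤ C * (N : ℝ) ^ (-η) * ∑' m : ℕ, ((m : ℝ) + 1) ^ (-1 - η) :=
        tsum_of_norm_bounded (hmajorant.hasSum.mul_left _) hterm
    _ = C * (∑' m : ℕ, ((m : ℝ) + 1) ^ (-1 - η)) * ‖(N : ℝ) ^ (-η)‖ := by
        rw [Real.norm_of_nonneg (by positivity)]
        ring

namespace PowerDecay

theorem zero : PowerDecay fun _ => 0 := ⟨1, one_pos, Asymptotics.isBigO_zero _ _⟩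

theorem add {e f : ℕ → ℂ} (he : PowerDecay e) (hf : PowerDecay f) :
    PowerDecay fun n => e n + f n := by
  obtain ⟨δ, hδ, he⟩ := he
  obtain ⟨ε, hε, hf⟩ := hf
  exact ⟨min δ ε, lt_min hδ hε,
    (he.trans (natCast_rpow_isBigO_rpow (neg_le_neg (min_le_left δ ε)))).add
      (hf.trans (natCast_rpow_isBigO_rpow (neg_le_neg (min_le_right δ ε))))⟩

theorem const_mul {e : ℕ → ℂ} (he : PowerDecay e) (c : ℂ) : PowerDecay fun n => c * e n := by
  obtain ⟨δ, hδ, he⟩ := he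
  exact ⟨δ, hδ, he.const_mul_left c⟩

theorem mul {e f : ℕ → ℂ} (he : PowerDecay e) (hf : PowerDecay f) :
    PowerDecay fun n => e n * f n := by
  obtain ⟨δ, hδ, he⟩ := he
  obtain ⟨ε, hε, hf⟩ := hf
  exact ⟨δ + ε, add_pos hδ hε, he.mul_atTop_rpow_natCast_of_isBigO_rpow _ _ _ hf (by linarith)⟩

theorem finset_sum {ι : Type*} (s : Finset ι) {e : ι → ℕ → ℂ} (h : ∀ i ∈ s, PowerDecay (e i)) :
    PowerDecay fun n => ∑ i ∈ s, e i n := by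
  classical
  induction s using Finset.induction_on with
  | empty => simpa using zero
  | insert i s hi ih =>
    simp only [Finset.sum_insert hi]
    exact (h i (Finset.mem_insert_self i s)).add
      (ih fun j hj => h j (Finset.mem_insert_of_mem hj))

theorem mul_logSeq {e : ℕ → ℂ} (he : PowerDecay e) : PowerDecay fun n => e n * logSeq n := by
  obtain ⟨δ, hδ, he⟩ := he
  have hlog : logSeq =O[atTop] fun n : ℕ => (n : ℝ) ^ (δ / 2) := by
    rw [← Asymptotics.isBigO_norm_left]
    simp only [norm_logSeq]
    exact (isLittleO_log_rpow_atTop (half_pos hδ)).isBigO.comp_tendsto tendsto_natCast_atTop_atTop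
  exact ⟨δ / 2, half_pos hδ, he.mul_atTop_rpow_natCast_of_isBigO_rpow _ _ _ hlog (by linarith)⟩

theorem mul_logSeq_pow {e : ℕ → ℂ} (he : PowerDecay e) (k : ℕ) :
    PowerDecay fun n => e n * logSeq n ^ k := by
  induction k with
  | zero => simpa using he
  | succ k ih => simpa only [pow_succ, mul_assoc] using ih.mul_logSeq

theorem mul_eval_logSeq {e : ℕ → ℂ} (he : PowerDecay e) (P : Polynomial ℂ) :
    PowerDecay fun n => e n * P.eval (logSeq n) := by
  simp only [Polynomial.eval_eq_sum, Polynomial.sum, Finset.mul_sum, mul_left_comm (e _)]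
  exact finset_sum _ fun k _ => (he.mul_logSeq_pow k).const_mul (P.coeff k)

theorem tendsto {e : ℕ → ℂ} (he : PowerDecay e) : Tendsto e atTop (𝓝 0) := by
  obtain ⟨δ, hδ, he⟩ := he
  exact he.trans_tendsto ((tendsto_rpow_neg_atTop hδ).comp tendsto_natCast_atTop_atTop)

end PowerDecay

theorem inv_succ_isBigO :
    (fun n : ℕ => ((n : ℂ) + 1)⁻¹) =O[atTop] fun n : ℕ => (n : ℝ) ^ (-1 : ℝ) := by
  refine .of_norm_eventuallyLE ?_
  filter_upwards [eventually_ge_atTop 1] with n hn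
  have hn_pos : (0 : ℝ) < n := by exact_mod_cast hn
  rw [norm_inv, norm_natCast_add_one, Real.rpow_neg_one]
  exact inv_anti₀ hn_pos (by linarith)

theorem powerDecay_inv_succ : PowerDecay fun n => ((n : ℂ) + 1)⁻¹ :=
  ⟨1, one_pos, inv_succ_isBigO⟩

theorem PowerDecay.exists_sum_div_succ_sub {e : ℕ → ℂ} (he : PowerDecay e) :
    ∃ c : ℂ, PowerDecay fun N => ∑ m ∈ Finset.range N, e m / ((m : ℂ) + 1) - c := by
  obtain ⟨δ, hδ, he⟩ := he
  refine ⟨∑' m : ℕ, e m / ((m : ℂ) + 1), δ / 2, half_pos hδ,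
    isBigO_sum_range_sub_tsum (half_pos hδ) ?_⟩
  simp only [div_eq_mul_inv]
  exact he.mul_atTop_rpow_natCast_of_isBigO_rpow _ _ _ inv_succ_isBigO (by linarith)

theorem powerDecay_logSeq_sub_mul :
    PowerDecay fun m => ((m : ℂ) + 1) * (logSeq (m + 1) - logSeq m) - 1 := by
  refine ⟨1, one_pos, .of_norm_eventuallyLE ?_⟩
  filter_upwards [eventually_ge_atTop 1] with m hm
  have hm_pos : (0 : ℝ) < m := by exact_mod_cast hm
  have hm_succ : (0 : ℝ) < (m : ℝ) + 1 := by linarith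
  have hquot : (0 : ℝ) < ((m : ℝ) + 1) / m := by positivity
  have hlower := Real.one_sub_inv_le_log_of_pos hquot
  have hupper := Real.log_le_sub_one_of_pos hquot
  have hlower_eq : 1 - (((m : ℝ) + 1) / m)⁻¹ = ((m : ℝ) + 1)⁻¹ := by
    field_simp
    ring
  have hupper_eq : ((m : ℝ) + 1) / m - 1 = (m : ℝ)⁻¹ := by
    field_simp
    ring
  rw [hlower_eq, inv_le_iff_one_le_mul₀' hm_succ, Real.log_div hm_succ.ne' hm_pos.ne'] at hlower
  rw [hupper_eq, Real.log_div hm_succ.ne' hm_pos.ne'] at hupper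
  have hcast : ((m : ℂ) + 1) * (logSeq (m + 1) - logSeq m) - 1 =
      ((((m : ℝ) + 1) * (Real.log ((m : ℝ) + 1) - Real.log m) - 1 : ℝ) : ℂ) := by
    simp [logSeq]
  rw [hcast, Complex.norm_real, Real.norm_of_nonneg (by linarith), Real.rpow_neg_one]
  calc ((m : ℝ) + 1) * (Real.log ((m : ℝ) + 1) - Real.log m) - 1
      ≤ ((m : ℝ) + 1) * (m : ℝ)⁻¹ - 1 := by gcongr
    _ = (m : ℝ)⁻¹ := by
        field_simp
        ring

theorem powerDecay_logSeq_sub : PowerDecay fun m => logSeq (m + 1) - logSeq m := by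
  convert (powerDecay_inv_succ.mul powerDecay_logSeq_sub_mul).add powerDecay_inv_succ using 2 with m
  have hm : (m : ℂ) + 1 ≠ 0 := Nat.cast_add_one_ne_zero m
  field_simp
  ring

/-- The discrete form of `d(log x)^k = k (log x)^{k-1} dx / x`; for `k = 0` the exponent `k - 1`
is truncated, harmlessly because of the factor `k`. -/
theorem powerDecay_logSeq_pow_sub_mul (k : ℕ) : PowerDecay fun m =>
    ((m : ℂ) + 1) * (logSeq (m + 1) ^ k - logSeq m ^ k) - k * logSeq m ^ (k - 1) := by
  induction k with
  | zero => simpa using PowerDecay.zero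
  | succ k ih =>
    convert ((ih.mul_logSeq.add (ih.mul powerDecay_logSeq_sub)).add
      ((powerDecay_logSeq_sub.mul_logSeq_pow (k - 1)).const_mul k)).add
      (powerDecay_logSeq_sub_mul.mul_logSeq_pow k) using 2 with m
    rcases k with _ | k
    · simp
    · push_cast
      ring

theorem exists_powerDecay_sum_logSeq_pow_div_succ_sub (k : ℕ) : ∃ c : ℂ, PowerDecay fun N =>
    ∑ m ∈ Finset.range N, logSeq m ^ k / ((m : ℂ) + 1) - (logSeq N ^ (k + 1) / (k + 1) - c) := by
  obtain ⟨c, hc⟩ := (powerDecay_logSeq_pow_sub_mul (k + 1)).exists_sum_div_succ_sub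
  have hk : (k : ℂ) + 1 ≠ 0 := Nat.cast_add_one_ne_zero k
  have htelescope (N : ℕ) : ∑ m ∈ Finset.range N, (((m : ℂ) + 1) *
      (logSeq (m + 1) ^ (k + 1) - logSeq m ^ (k + 1)) -
        ((k + 1 : ℕ) : ℂ) * logSeq m ^ (k + 1 - 1)) / ((m : ℂ) + 1) =
      logSeq N ^ (k + 1) - (k + 1) * ∑ m ∈ Finset.range N, logSeq m ^ k / ((m : ℂ) + 1) := by
    have hlog : ∑ m ∈ Finset.range N, (logSeq (m + 1) ^ (k + 1) - logSeq m ^ (k + 1)) =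
        logSeq N ^ (k + 1) := by
      rw [Finset.sum_range_sub fun m => logSeq m ^ (k + 1)]
      simp [logSeq]
    rw [← hlog, Finset.mul_sum, ← Finset.sum_sub_distrib]
    refine Finset.sum_congr rfl fun m _ => ?_
    have hm : (m : ℂ) + 1 ≠ 0 := Nat.cast_add_one_ne_zero m
    rw [Nat.add_sub_cancel]
    push_cast
    field_simp
  refine ⟨c / (k + 1), ?_⟩
  convert hc.const_mul (-1 / (k + 1)) using 2 with N
  rw [htelescope]
  field_simp
  ring

/-! ### Expansions in powers of the logarithm -/

/-- `f n` is a polynomial in `log n` with constant term `c`, up to an error of power decay: the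
shape in which all the finite parts of harmonic sums arise. -/
def HasLogExpansion (f : ℕ → ℂ) (c : ℂ) : Prop :=
  ∃ P : Polynomial ℂ, P.coeff 0 = c ∧ PowerDecay fun n => f n - P.eval (logSeq n)

namespace HasLogExpansion

theorem of_powerDecay_sub {f : ℕ → ℂ} {c : ℂ} (hf : PowerDecay fun n => f n - c) :
    HasLogExpansion f c :=
  ⟨Polynomial.C c, by simp, by simpa using hf⟩

theorem const (c : ℂ) : HasLogExpansion (fun _ => c) c :=
  of_powerDecay_sub (by simpa using PowerDecay.zero)

theorem add {f g : ℕ → ℂ} {c d : ℂ} (hf : HasLogExpansion f c) (hg : HasLogExpansion g d) :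
    HasLogExpansion (fun n => f n + g n) (c + d) := by
  obtain ⟨P, rfl, hP⟩ := hf
  obtain ⟨Q, rfl, hQ⟩ := hg
  refine ⟨P + Q, Polynomial.coeff_add P Q 0, ?_⟩
  convert hP.add hQ using 2
  rw [Polynomial.eval_add]
  ring

theorem mul {f g : ℕ → ℂ} {c d : ℂ} (hf : HasLogExpansion f c) (hg : HasLogExpansion g d) :
    HasLogExpansion (fun n => f n * g n) (c * d) := by
  obtain ⟨P, rfl, hP⟩ := hf
  obtain ⟨Q, rfl, hQ⟩ := hg
  refine ⟨P * Q, Polynomial.mul_coeff_zero P Q, ?_⟩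
  convert ((hP.mul hQ).add (hP.mul_eval_logSeq Q)).add (hQ.mul_eval_logSeq P) using 2
  rw [Polynomial.eval_mul]
  ring

theorem const_mul {f : ℕ → ℂ} {c : ℂ} (hf : HasLogExpansion f c) (x : ℂ) :
    HasLogExpansion (fun n => x * f n) (x * c) :=
  (const x).mul hf

theorem finset_sum {ι : Type*} (s : Finset ι) {f : ι → ℕ → ℂ} {c : ι → ℂ}
    (h : ∀ i ∈ s, HasLogExpansion (f i) (c i)) :
    HasLogExpansion (fun n => ∑ i ∈ s, f i n) (∑ i ∈ s, c i) := by
  classical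
  induction s using Finset.induction_on with
  | empty => simpa using const 0
  | insert i s hi ih =>
    simp only [Finset.sum_insert hi]
    exact (h i (Finset.mem_insert_self i s)).add
      (ih fun j hj => h j (Finset.mem_insert_of_mem hj))

theorem pow {f : ℕ → ℂ} {c : ℂ} (hf : HasLogExpansion f c) (k : ℕ) :
    HasLogExpansion (fun n => f n ^ k) (c ^ k) := by
  induction k with
  | zero => simpa using const 1
  | succ k ih => simpa only [pow_succ] using ih.mul hf

theorem div_succ {f : ℕ → ℂ} {c : ℂ} (hf : HasLogExpansion f c) :
    HasLogExpansion (fun n => f n / ((n : ℂ) + 1)) 0 := by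
  have hinv : HasLogExpansion (fun n => ((n : ℂ) + 1)⁻¹) 0 :=
    of_powerDecay_sub (by simpa only [sub_zero] using powerDecay_inv_succ)
  simpa only [div_eq_mul_inv, mul_zero] using hf.mul hinv

theorem exists_div_succ_pow {f : ℕ → ℂ} {c : ℂ} (hf : HasLogExpansion f c) (k : ℕ) :
    ∃ d, HasLogExpansion (fun n => f n / ((n : ℂ) + 1) ^ k) d := by
  induction k with
  | zero => exact ⟨c, by simpa using hf⟩
  | succ k ih =>
    obtain ⟨d, hd⟩ := ih
    exact ⟨0, by simpa only [pow_succ, div_div] using hd.div_succ⟩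

theorem exists_sum_logSeq_pow_div_succ (k : ℕ) :
    ∃ d, HasLogExpansion (fun N => ∑ m ∈ Finset.range N, logSeq m ^ k / ((m : ℂ) + 1)) d := by
  obtain ⟨c, hc⟩ := exists_powerDecay_sum_logSeq_pow_div_succ_sub k
  refine ⟨_, Polynomial.X ^ (k + 1) * Polynomial.C (1 / ((k : ℂ) + 1)) - Polynomial.C c, rfl, ?_⟩
  simpa only [Polynomial.eval_sub, Polynomial.eval_mul, Polynomial.eval_pow, Polynomial.eval_X,
    Polynomial.eval_C, mul_one_div] using hc

theorem exists_sum_div_succ {f : ℕ → ℂ} {c : ℂ} (hf : HasLogExpansion f c) :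
    ∃ d, HasLogExpansion (fun N => ∑ m ∈ Finset.range N, f m / ((m : ℂ) + 1)) d := by
  obtain ⟨P, -, hP⟩ := hf
  obtain ⟨c, hc⟩ := hP.exists_sum_div_succ_sub
  choose d hd using exists_sum_logSeq_pow_div_succ
  refine ⟨c + ∑ k ∈ P.support, P.coeff k * d k, ?_⟩
  convert (of_powerDecay_sub hc).add
    (finset_sum P.support fun k _ => (hd k).const_mul (P.coeff k)) using 2 with N
  simp only [Finset.mul_sum]
  rw [Finset.sum_comm, ← Finset.sum_add_distrib]
  refine Finset.sum_congr rfl fun m _ => ?_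
  simp only [mul_div_assoc', ← Finset.sum_div]
  rw [← add_div, Polynomial.eval_eq_sum, Polynomial.sum, sub_add_cancel]

theorem tendsto_of_norm_le {f : ℕ → ℂ} {B : ℝ} {c : ℂ} (hf : HasLogExpansion f c)
    (hB : ∀ n, ‖f n‖ ≤ B) : Tendsto f atTop (𝓝 c) := by
  obtain ⟨P, rfl, hP⟩ := hf
  have herror := hP.tendsto
  have hdegree : P.degree ≤ 0 := by
    by_contra! hpos
    have heval : Tendsto (fun n : ℕ => ‖P.eval (logSeq n)‖) atTop atTop :=
      P.tendsto_norm_atTop hpos (by simpa only [norm_logSeq] using tendsto_log_natCast_atTop)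
    obtain ⟨n, hlarge, hsmall⟩ := ((heval.eventually_gt_atTop (B + 1)).and
      (herror.norm.eventually_lt_const (by simp : ‖(0 : ℂ)‖ < 1))).exists
    have htriangle := norm_sub_norm_le (P.eval (logSeq n)) (f n)
    rw [norm_sub_rev] at htriangle
    linarith [hB n]
  rw [Polynomial.eq_C_of_degree_le_zero hdegree] at herror ⊢
  simpa using herror.add_const (P.coeff 0)

theorem hasFinitePart {f : ℕ → ℂ} {c : ℂ} (hf : HasLogExpansion f c) : HasFinitePart f c := by
  obtain ⟨P, rfl, hP⟩ := hf
  refine ⟨∑ k ∈ P.support, Finsupp.single (0, k) (P.coeff k), ?_, hP.tendsto.congr fun n => ?_⟩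
  · rw [Finsupp.finsetSum_apply, Finset.sum_eq_single 0]
    · simp
    · intro k _ hk
      simp [hk]
    · simp
  · rw [← Finsupp.sum_finsetSum_index (by simp) (by intros; ring), Polynomial.eval_eq_sum,
      Polynomial.sum]
    congr 1
    refine Finset.sum_congr rfl fun k _ => ?_
    rw [Finsupp.sum_single_index (by simp)]
    simp [logSeq]

end HasLogExpansion

theorem exists_hasLogExpansion_harmonicSum (w : Word) :
    ∃ c, HasLogExpansion (harmonicSum w) c := by
  induction w with
  | nil => exact ⟨1, .const 1⟩
  | cons s w ih =>
    obtain ⟨c, hc⟩ := ih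
    obtain ⟨d, hd⟩ := hc.exists_div_succ_pow s.natPred
    obtain ⟨e, he⟩ := hd.exists_sum_div_succ
    simp only [div_div, ← pow_succ, s.natPred_add_one] at he
    exact ⟨e, he⟩

/-! ### Uniqueness of finite parts -/

/-- The function `n^a (log n)^b` of the asymptotic scale, for `p = (a, b)`. Growth at infinity is
governed by the lexicographic order on the exponents. -/
def scale (p : ℤ × ℕ) (n : ℕ) : ℂ := (n : ℂ) ^ p.1 * logSeq n ^ p.2

theorem norm_scale (p : ℤ × ℕ) (n : ℕ) : ‖scale p n‖ = (n : ℝ) ^ p.1 * Real.log n ^ p.2 := by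
  simp [scale, norm_logSeq]

theorem isLittleO_scale {p q : ℤ × ℕ} (h : toLex p < toLex q) :
    scale p =o[atTop] scale q := by
  rw [← Asymptotics.isLittleO_norm_norm]
  simp only [norm_scale]
  rcases Prod.Lex.toLex_lt_toLex.1 h with hfst | ⟨hfst, hsnd⟩
  · have hpow : (fun n : ℕ => (n : ℝ) ^ p.1 * n) =O[atTop] fun n : ℕ => (n : ℝ) ^ q.1 := by
      refine .of_norm_eventuallyLE ?_
      filter_upwards [eventually_ge_atTop 1] with n hn
      have hn_one : (1 : ℝ) ≤ n := by exact_mod_cast hn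
      rw [Real.norm_of_nonneg (by positivity), ← zpow_add_one₀ (by positivity)]
      exact zpow_le_zpow_right₀ hn_one hfst
    have hlog : (fun n : ℕ => Real.log (n : ℝ) ^ p.2) =o[atTop] fun n : ℕ => (n : ℝ) :=
      Real.isLittleO_pow_log_id_atTop.comp_tendsto tendsto_natCast_atTop_atTop
    have hone : (fun _ : ℕ => (1 : ℝ)) =O[atTop] fun n : ℕ => Real.log (n : ℝ) ^ q.2 := by
      refine .of_norm_eventuallyLE ?_
      filter_upwards [tendsto_log_natCast_atTop.eventually_ge_atTop 1] with n hn
      rw [norm_one]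
      exact one_le_pow₀ hn
    have hmain := (((Asymptotics.isBigO_refl (fun n : ℕ => (n : ℝ) ^ p.1) atTop).mul_isLittleO
      hlog).trans_isBigO hpow).mul_isBigO hone
    simpa only [mul_one] using hmain
  · rw [hfst]
    exact (Asymptotics.isBigO_refl _ _).mul_isLittleO
      ((Asymptotics.isLittleO_pow_pow_atTop_of_lt hsnd).comp_tendsto tendsto_log_natCast_atTop)

theorem isBigO_scale {p q : ℤ × ℕ} (h : toLex p ≤ toLex q) : scale p =O[atTop] scale q := by
  rcases h.eq_or_lt with heq | hlt
  · rw [toLex.injective heq]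
  · exact (isLittleO_scale hlt).isBigO

theorem eventually_scale_ne_zero (p : ℤ × ℕ) : ∀ᶠ n in atTop, scale p n ≠ 0 := by
  filter_upwards [tendsto_log_natCast_atTop.eventually_gt_atTop 0, eventually_gt_atTop 0]
    with n hlog hn
  rw [← norm_pos_iff, norm_scale]
  positivity

/-- Compare with the dominant term among the terms of the combination and `scale (0, 0) = 1`. -/
theorem apply_zero_eq_zero_of_tendsto_sum_scale {C : (ℤ × ℕ) →₀ ℂ}
    (h : Tendsto (fun n => C.sum fun p k => k * scale p n) atTop (𝓝 0)) : C (0, 0) = 0 := by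
  obtain ⟨M, hM_mem, hM_max⟩ := (insert (0, 0) C.support).exists_max_image toLex ⟨(0, 0), by simp⟩
  have hsum : (fun n => C.sum fun p k => k * scale p n) =o[atTop] scale M := by
    have hone : scale (0, 0) = fun _ => 1 := by
      ext n
      simp [scale]
    refine Asymptotics.IsLittleO.trans_isBigO ?_ (isBigO_scale (hM_max (0, 0) (by simp)))
    rwa [hone, Asymptotics.isLittleO_one_iff]
  have hrest : (fun n => ∑ p ∈ C.support.erase M, C p * scale p n) =o[atTop] scale M := by
    refine .fun_sum fun p hp => (isLittleO_scale ?_).const_mul_left _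
    obtain ⟨hp_ne, hp_mem⟩ := Finset.mem_erase.1 hp
    exact (hM_max p (Finset.mem_insert_of_mem hp_mem)).lt_of_ne (toLex.injective.ne hp_ne)
  have hterm : (fun n => C M * scale M n) =o[atTop] scale M := by
    refine (hsum.sub hrest).congr_left fun n => ?_
    by_cases hM : M ∈ C.support
    · rw [Finsupp.sum, ← Finset.add_sum_erase _ _ hM, add_sub_cancel_right]
    · rw [Finset.erase_eq_of_notMem hM, Finsupp.sum, sub_self, Finsupp.notMem_support_iff.1 hM,
        zero_mul]
  have hCM : C M = 0 := by
    by_contra hCM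
    exact Asymptotics.isLittleO_irrefl (eventually_scale_ne_zero M).frequently
      ((Asymptotics.isLittleO_const_mul_left_iff hCM).1 hterm)
  rcases Finset.mem_insert.1 hM_mem with rfl | hM
  · exact hCM
  · exact absurd hCM (Finsupp.mem_support_iff.1 hM)

theorem hasFinitePart_unique {f : ℕ → ℂ} {c d : ℂ} (hc : HasFinitePart f c)
    (hd : HasFinitePart f d) : c = d := by
  obtain ⟨C, rfl, hC⟩ := hc
  obtain ⟨D, rfl, hD⟩ := hd
  have hdiff : (C - D) (0, 0) = 0 := by
    refine apply_zero_eq_zero_of_tendsto_sum_scale ?_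
    refine (sub_zero (0 : ℂ) ▸ hD.sub hC).congr fun n => ?_
    rw [Finsupp.sum_sub_index (by intros; ring)]
    simp only [scale, logSeq]
    ring
  exact sub_eq_zero.1 (by rwa [Finsupp.sub_apply] at hdiff)

theorem HasLogExpansion.unique {f : ℕ → ℂ} {c d : ℂ} (hc : HasLogExpansion f c)
    (hd : HasLogExpansion f d) : c = d :=
  hasFinitePart_unique hc.hasFinitePart hd.hasFinitePart

theorem hasFinitePart_gammaWord (w : Word) : HasFinitePart (harmonicSum w) (gammaWord w) := by
  obtain ⟨c, hc⟩ := exists_hasLogExpansion_harmonicSum w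
  exact Classical.epsilon_spec ⟨c, hc.hasFinitePart⟩

theorem hasLogExpansion_gammaWord (w : Word) :
    HasLogExpansion (harmonicSum w) (gammaWord w) := by
  obtain ⟨c, hc⟩ := exists_hasLogExpansion_harmonicSum w
  rwa [hasFinitePart_unique (hasFinitePart_gammaWord w) hc.hasFinitePart]

theorem gammaWord_one : gammaWord [1] = (Real.eulerMascheroniConstant : ℂ) := by
  refine hasFinitePart_unique (hasFinitePart_gammaWord [1])
    ⟨Finsupp.single (0, 0) (Real.eulerMascheroniConstant : ℂ) + Finsupp.single (0, 1) 1,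
      by simp, ?_⟩
  have hlimit : Tendsto (fun n : ℕ =>
      ((harmonic n - Real.log n - Real.eulerMascheroniConstant : ℝ) : ℂ)) atTop (𝓝 0) := by
    have hreal := Real.tendsto_harmonic_sub_log.sub_const Real.eulerMascheroniConstant
    rw [sub_self] at hreal
    exact_mod_cast (Complex.continuous_ofReal.tendsto 0).comp hreal
  refine hlimit.congr fun n => ?_
  rw [Finsupp.sum_add_index' (by simp) (by intros; ring), Finsupp.sum_single_index (by simp),
    Finsupp.sum_single_index (by simp)]
  simp only [harmonic, harmonicSum, Finset.sum_range, zpow_zero, pow_zero, pow_one, one_mul,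
    mul_one, PNat.one_coe]
  push_cast
  simp only [one_div]
  ring

/-! ### Generating series by weight -/

/-- The power series `1 + ∑_{s ≥ 1} a_s X^s`. -/
def letterSeries (a : ℕ+ → ℂ) : PowerSeries ℂ :=
  PowerSeries.mk fun n => if n = 0 then 1 else a n.toPNat'

/-- The generating series by weight of the harmonic sums `H_w(N)`, weighted by the coefficients of
the star of `∑_s a_s y_s`. It is multiplicative in `a` for `starLaw` because it factors over the
summation indices `m + 1 ≤ N`. -/
def harmonicSeries (a : ℕ+ → ℂ) (N : ℕ) : PowerSeries ℂ :=
  ∏ m ∈ Finset.range N, PowerSeries.rescale ((m : ℂ) + 1)⁻¹ (letterSeries a)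

/-- The generating series by weight of the values of `γ` on the star of `∑_s a_s y_s`. -/
def gammaGen (a : ℕ+ → ℂ) : PowerSeries ℂ :=
  PowerSeries.mk (gammaComponent (kleeneStar (letters a)))

theorem coeff_zero_letterSeries (a : ℕ+ → ℂ) : PowerSeries.coeff 0 (letterSeries a) = 1 := by
  simp [letterSeries]

theorem coeff_letterSeries_of_ne_zero (a : ℕ+ → ℂ) {n : ℕ} (hn : n ≠ 0) :
    PowerSeries.coeff n (letterSeries a) = a n.toPNat' := by
  simp [letterSeries, hn]

theorem coeff_letterSeries_pnat (a : ℕ+ → ℂ) (s : ℕ+) :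
    PowerSeries.coeff (s : ℕ) (letterSeries a) = a s := by
  rw [coeff_letterSeries_of_ne_zero a s.ne_zero, PNat.coe_toPNat']

theorem sum_wordsOfWeight_eq_sum_antidiagonal {M : Type*} [AddCommMonoid M] (n : ℕ) (f : Word → M)
    (hf : f [] = 0) :
    ∑ w ∈ wordsOfWeight n, f w = ∑ p ∈ Finset.HasAntidiagonal.antidiagonal n,
      if p.1 = 0 then 0 else ∑ w ∈ wordsOfWeight p.2, f (p.1.toPNat' :: w) := by
  simp only [← ite_not (_ = _) _ (0 : M)]
  rw [← Finset.sum_filter, Finset.sum_sigma', ← Finset.sum_filter_of_ne (s := wordsOfWeight n)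
    (p := (· ≠ [])) (fun w _ hw hw_nil => hw (by rw [hw_nil, hf]))]
  symm
  refine Finset.sum_bij' (fun x _ => x.1.1.toPNat' :: x.2)
    (fun w _ => ⟨(weight [w.headI], weight w.tail), w.tail⟩) ?_ ?_ ?_ ?_ fun _ _ => rfl
  · rintro ⟨⟨i, j⟩, w⟩ hx
    simp only [Finset.mem_sigma, Finset.mem_filter, Finset.HasAntidiagonal.mem_antidiagonal,
      mem_wordsOfWeight] at hx
    simp [weight_cons, Nat.toPNat'_coe, Nat.pos_of_ne_zero hx.1.2, hx.2, hx.1.1]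
  · intro w hw
    rcases w with _ | ⟨s, w⟩
    · simp at hw
    · simpa [weight_cons, weight_nil, mem_wordsOfWeight] using hw
  · rintro ⟨⟨i, j⟩, w⟩ hx
    simp only [Finset.mem_sigma, Finset.mem_filter, mem_wordsOfWeight] at hx
    simp [weight_cons, weight_nil, Nat.toPNat'_coe, Nat.pos_of_ne_zero hx.1.2, hx.2]
  · intro w hw
    rcases w with _ | ⟨s, w⟩
    · simp at hw
    · simp [weight_cons, weight_nil]

theorem harmonicSum_cons_succ (s : ℕ+) (w : Word) (N : ℕ) :
    harmonicSum (s :: w) (N + 1) =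
      harmonicSum (s :: w) N + harmonicSum w N / ((N : ℂ) + 1) ^ (s : ℕ) :=
  Finset.sum_range_succ _ N

theorem sum_kleeneStar_mul_harmonicSum_succ (a : ℕ+ → ℂ) (n N : ℕ) :
    ∑ w ∈ wordsOfWeight n, kleeneStar (letters a) w * harmonicSum w (N + 1) =
      ∑ p ∈ Finset.HasAntidiagonal.antidiagonal n,
        PowerSeries.coeff p.1 (PowerSeries.rescale ((N : ℂ) + 1)⁻¹ (letterSeries a)) *
          ∑ w ∈ wordsOfWeight p.2, kleeneStar (letters a) w * harmonicSum w N := by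
  have hincrement := sum_wordsOfWeight_eq_sum_antidiagonal n
    (fun w => kleeneStar (letters a) w * (harmonicSum w (N + 1) - harmonicSum w N))
    (by simp [harmonicSum])
  simp only [mul_sub, Finset.sum_sub_distrib, sub_eq_iff_eq_add'] at hincrement
  rw [hincrement, Finset.Nat.sum_antidiagonal_eq_sum_range_succ_mk,
    Finset.Nat.sum_antidiagonal_eq_sum_range_succ_mk, Finset.sum_range_succ',
    Finset.sum_range_succ' _ n]
  simp only [Nat.sub_zero, if_true, Nat.add_eq_zero_iff, one_ne_zero, and_false, if_false,
    add_zero, PowerSeries.coeff_rescale, pow_zero, coeff_zero_letterSeries, one_mul]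
  rw [add_comm]
  congr 1
  refine Finset.sum_congr rfl fun i _ => ?_
  rw [coeff_letterSeries_of_ne_zero a i.succ_ne_zero, ← Finset.sum_sub_distrib, Finset.mul_sum]
  refine Finset.sum_congr rfl fun w _ => ?_
  rw [harmonicSum_cons_succ, kleeneStar_letters_cons, Nat.toPNat'_coe, if_pos i.succ_pos, inv_pow]
  ring

theorem coeff_harmonicSeries (a : ℕ+ → ℂ) (n N : ℕ) :
    PowerSeries.coeff n (harmonicSeries a N) =
      ∑ w ∈ wordsOfWeight n, kleeneStar (letters a) w * harmonicSum w N := by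
  induction N generalizing n with
  | zero =>
    have hsum_zero (w : Word) : harmonicSum w 0 = if w = [] then 1 else 0 := by
      cases w <;> simp [harmonicSum]
    simp only [hsum_zero, mul_ite, mul_one, mul_zero, harmonicSeries, Finset.range_zero,
      Finset.prod_empty, PowerSeries.coeff_one]
    rw [Finset.sum_ite_eq']
    simp [kleeneStar_letters_nil, mem_wordsOfWeight, weight_nil, eq_comm]
  | succ N ih =>
    rw [harmonicSeries, Finset.prod_range_succ, mul_comm, ← harmonicSeries, PowerSeries.coeff_mul,
      sum_kleeneStar_mul_harmonicSum_succ]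
    simp only [ih]

/-! ### Coefficientwise expansions and multiplicativity -/

/-- The coefficients of `H N` have expansions in powers of `log N`, with constant terms those of
`c`. -/
def HasLogExpansionCoeff (H : ℕ → PowerSeries ℂ) (c : PowerSeries ℂ) : Prop :=
  ∀ n, HasLogExpansion (fun N => PowerSeries.coeff n (H N)) (PowerSeries.coeff n c)

theorem HasLogExpansionCoeff.mul {H K : ℕ → PowerSeries ℂ} {c d : PowerSeries ℂ}
    (hH : HasLogExpansionCoeff H c) (hK : HasLogExpansionCoeff K d) :
    HasLogExpansionCoeff (fun N => H N * K N) (c * d) := by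
  intro n
  simp only [PowerSeries.coeff_mul]
  exact .finset_sum _ fun p _ => (hH p.1).mul (hK p.2)

theorem HasLogExpansionCoeff.unique {H : ℕ → PowerSeries ℂ} {c d : PowerSeries ℂ}
    (hc : HasLogExpansionCoeff H c) (hd : HasLogExpansionCoeff H d) : c = d :=
  PowerSeries.ext fun n => (hc n).unique (hd n)

theorem hasLogExpansionCoeff_harmonicSeries (a : ℕ+ → ℂ) :
    HasLogExpansionCoeff (harmonicSeries a) (gammaGen a) := by
  intro n
  simp only [coeff_harmonicSeries, gammaGen, PowerSeries.coeff_mk]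
  exact .finset_sum _ fun w _ => (hasLogExpansion_gammaWord w).const_mul _

theorem sum_antidiagonal_eq_add_sum_splittings {M : Type*} [AddCommMonoid M] (s : ℕ+)
    (f : ℕ × ℕ → M) :
    ∑ p ∈ Finset.HasAntidiagonal.antidiagonal (s : ℕ), f p =
      f (0, s) + (f (s, 0) + ∑ q ∈ splittings s, f (q.1, q.2)) := by
  have hsplit : Finset.HasAntidiagonal.antidiagonal (s : ℕ) =
      insert (0, (s : ℕ)) (insert ((s : ℕ), 0)
        ((splittings s).image fun q => ((q.1 : ℕ), (q.2 : ℕ)))) := by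
    ext ⟨i, j⟩
    simp only [Finset.HasAntidiagonal.mem_antidiagonal, Finset.mem_insert, Finset.mem_image,
      mem_splittings, Prod.mk.injEq, Prod.exists, ← PNat.coe_inj, PNat.add_coe]
    constructor
    · intro hij
      rcases Nat.eq_zero_or_pos i with rfl | hi
      · omega
      rcases Nat.eq_zero_or_pos j with rfl | hj
      · omega
      exact .inr (.inr ⟨⟨i, hi⟩, ⟨j, hj⟩, hij, rfl, rfl⟩)
    · rintro (⟨rfl, rfl⟩ | ⟨rfl, rfl⟩ | ⟨p, q, hpq, rfl, rfl⟩) <;> omega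
  rw [hsplit, Finset.sum_insert, Finset.sum_insert, Finset.sum_image]
  · rintro ⟨p, q⟩ _ ⟨p', q'⟩ _ h
    simpa using h
  · simp
  · simp [s.ne_zero.symm]

theorem letterSeries_starLaw (a b : ℕ+ → ℂ) :
    letterSeries (starLaw a b) = letterSeries a * letterSeries b := by
  ext n
  rw [PowerSeries.coeff_mul]
  rcases Nat.eq_zero_or_pos n with rfl | hn
  · simp [coeff_zero_letterSeries]
  · lift n to ℕ+ using hn
    rw [sum_antidiagonal_eq_add_sum_splittings]
    simp only [coeff_zero_letterSeries, coeff_letterSeries_pnat, starLaw]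
    ring

theorem harmonicSeries_starLaw (a b : ℕ+ → ℂ) (N : ℕ) :
    harmonicSeries (starLaw a b) N = harmonicSeries a N * harmonicSeries b N := by
  simp only [harmonicSeries, letterSeries_starLaw, map_mul, Finset.prod_mul_distrib]

theorem gammaGen_starLaw (a b : ℕ+ → ℂ) :
    gammaGen (starLaw a b) = gammaGen a * gammaGen b := by
  refine (hasLogExpansionCoeff_harmonicSeries _).unique ?_
  simpa only [← harmonicSeries_starLaw] using
    (hasLogExpansionCoeff_harmonicSeries a).mul (hasLogExpansionCoeff_harmonicSeries b)

theorem gammaComponent_starLaw (a b : ℕ+ → ℂ) (n : ℕ) :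
    gammaComponent (kleeneStar (letters (starLaw a b))) n =
      ∑ p ∈ Finset.HasAntidiagonal.antidiagonal n, gammaComponent (kleeneStar (letters a)) p.1 *
        gammaComponent (kleeneStar (letters b)) p.2 := by
  have hcoeff := congrArg (PowerSeries.coeff n) (gammaGen_starLaw a b)
  simpa only [PowerSeries.coeff_mul, gammaGen, PowerSeries.coeff_mk] using hcoeff

theorem summable_norm_mul_pow_of_tendsto_sum {f : ℕ → ℂ} {l : ℂ}
    (hf : Tendsto (fun N => ∑ n ∈ Finset.range N, f n) atTop (𝓝 l)) {x : ℝ} (hx₀ : 0 ≤ x)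
    (hx₁ : x < 1) : Summable fun n => ‖f n * (x : ℂ) ^ n‖ := by
  have hzero : Tendsto f atTop (𝓝 0) := by
    simpa [Finset.sum_range_succ] using (hf.comp (tendsto_add_atTop_nat 1)).sub hf
  obtain ⟨C, hC⟩ := hzero.norm.bddAbove_range
  refine .of_nonneg_of_le (fun _ => norm_nonneg _) (fun n => ?_)
    ((summable_geometric_of_lt_one hx₀ hx₁).mul_left C)
  rw [norm_mul, norm_pow, Complex.norm_real, Real.norm_of_nonneg hx₀]
  exact mul_le_mul_of_nonneg_right (hC ⟨n, rfl⟩) (by positivity)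

/-- Abel's theorem on Cauchy products: by the Cauchy product formula the identity holds inside the
disc of convergence, and Abel's limit theorem extends it to the boundary point `1`. -/
theorem eq_mul_of_tendsto_sum_antidiagonal {f g : ℕ → ℂ} {A B D : ℂ}
    (hf : Tendsto (fun N => ∑ n ∈ Finset.range N, f n) atTop (𝓝 A))
    (hg : Tendsto (fun N => ∑ n ∈ Finset.range N, g n) atTop (𝓝 B))
    (hfg : Tendsto (fun N => ∑ n ∈ Finset.range N,
      ∑ p ∈ Finset.HasAntidiagonal.antidiagonal n, f p.1 * g p.2) atTop (𝓝 D)) : D = A * B := by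
  have hA := Complex.tendsto_tsum_powerSeries_nhdsWithin_lt hf
  have hB := Complex.tendsto_tsum_powerSeries_nhdsWithin_lt hg
  have hD := Complex.tendsto_tsum_powerSeries_nhdsWithin_lt hfg
  rw [tendsto_map'_iff] at hA hB hD
  refine tendsto_nhds_unique hD ((hA.mul hB).congr' ?_)
  filter_upwards [Ioo_mem_nhdsLT (zero_lt_one (α := ℝ))] with x ⟨hx₀, hx₁⟩
  simp only [Function.comp_apply]
  rw [tsum_mul_tsum_eq_tsum_sum_antidiagonal_of_summable_norm
    (summable_norm_mul_pow_of_tendsto_sum hf hx₀.le hx₁)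
    (summable_norm_mul_pow_of_tendsto_sum hg hx₀.le hx₁)]
  refine tsum_congr fun n => ?_
  rw [Finset.sum_mul]
  refine Finset.sum_congr rfl fun p hp => ?_
  rw [← Finset.HasAntidiagonal.mem_antidiagonal.1 hp, pow_add]
  ring

theorem gammaSeries_starLaw {a b : ℕ+ → ℂ} (ha : kleeneStar (letters a) ∈ gammaDom)
    (hb : kleeneStar (letters b) ∈ gammaDom)
    (hab : kleeneStar (letters (starLaw a b)) ∈ gammaDom) :
    gammaSeries (kleeneStar (letters (starLaw a b))) =
      gammaSeries (kleeneStar (letters a)) * gammaSeries (kleeneStar (letters b)) := by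
  refine eq_mul_of_tendsto_sum_antidiagonal (tendsto_nhds_limUnder ha)
    (tendsto_nhds_limUnder hb) ?_
  simpa only [gammaSeries, gammaComponent_starLaw] using tendsto_nhds_limUnder hab

/-! ### Absolutely summable power series -/

section AbsSummable

variable {R : Type*} [NormedCommRing R]

/-- Absolute convergence at `1`. The power series with this property form a Banach algebra with
norm `absNorm`, and `coeffSum`, the evaluation at `1`, is a character of it. -/
def AbsSummable (F : PowerSeries R) : Prop := Summable fun n => ‖PowerSeries.coeff n F‖

/-- The sum of the norms of the coefficients, meaningful for `AbsSummable` power series. -/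
def absNorm (F : PowerSeries R) : ℝ := ∑' n, ‖PowerSeries.coeff n F‖

/-- The sum of the coefficients, meaningful for `AbsSummable` power series. -/
def coeffSum (F : PowerSeries R) : R := ∑' n, PowerSeries.coeff n F

theorem norm_coeff_mul_le (F G : PowerSeries R) (n : ℕ) :
    ‖PowerSeries.coeff n (F * G)‖ ≤ ∑ p ∈ Finset.HasAntidiagonal.antidiagonal n,
      ‖PowerSeries.coeff p.1 F‖ * ‖PowerSeries.coeff p.2 G‖ := by
  rw [PowerSeries.coeff_mul]
  exact norm_sum_le_of_le _ fun _ _ => norm_mul_le _ _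

theorem absNorm_nonneg (F : PowerSeries R) : 0 ≤ absNorm F := tsum_nonneg fun _ => norm_nonneg _

theorem absNorm_one [NormOneClass R] : absNorm (1 : PowerSeries R) = 1 := by
  rw [absNorm, tsum_eq_single 0]
  · simp
  · intro n hn
    simp [PowerSeries.coeff_one, hn]

theorem coeffSum_one : coeffSum (1 : PowerSeries R) = 1 := by
  rw [coeffSum, tsum_eq_single 0]
  · simp
  · intro n hn
    simp [PowerSeries.coeff_one, hn]

namespace AbsSummable

variable {F G : PowerSeries R}

theorem summable_antidiagonal (hF : AbsSummable F) (hG : AbsSummable G) :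
    Summable fun n => ∑ p ∈ Finset.HasAntidiagonal.antidiagonal n,
      ‖PowerSeries.coeff p.1 F‖ * ‖PowerSeries.coeff p.2 G‖ :=
  (summable_norm_sum_mul_antidiagonal_of_summable_norm hF.norm hG.norm).of_norm

theorem mul (hF : AbsSummable F) (hG : AbsSummable G) : AbsSummable (F * G) :=
  .of_nonneg_of_le (fun _ => norm_nonneg _) (norm_coeff_mul_le F G) (hF.summable_antidiagonal hG)

theorem one : AbsSummable (1 : PowerSeries R) :=
  summable_of_ne_finset_zero (s := {0}) fun n hn => by
    simp [PowerSeries.coeff_one, Finset.notMem_singleton.1 hn]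

theorem prod {ι : Type*} (s : Finset ι) {F : ι → PowerSeries R} (h : ∀ i ∈ s, AbsSummable (F i)) :
    AbsSummable (∏ i ∈ s, F i) :=
  Finset.prod_induction F AbsSummable (fun _ _ => mul) one h

theorem rescale [NormOneClass R] (hF : AbsSummable F) {x : R} (hx : ‖x‖ ≤ 1) :
    AbsSummable (PowerSeries.rescale x F) := by
  refine .of_nonneg_of_le (fun _ => norm_nonneg _) (fun n => ?_) hF
  rw [PowerSeries.coeff_rescale]
  exact (norm_mul_le _ _).trans (mul_le_of_le_one_left (norm_nonneg _)
    ((norm_pow_le x n).trans (pow_le_one₀ (norm_nonneg _) hx)))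

theorem norm_coeff_le (hF : AbsSummable F) (n : ℕ) : ‖PowerSeries.coeff n F‖ ≤ absNorm F :=
  hF.le_tsum n fun _ _ => norm_nonneg _

theorem absNorm_mul_le (hF : AbsSummable F) (hG : AbsSummable G) :
    absNorm (F * G) ≤ absNorm F * absNorm G :=
  calc absNorm (F * G)
      ≤ ∑' n, ∑ p ∈ Finset.HasAntidiagonal.antidiagonal n,
          ‖PowerSeries.coeff p.1 F‖ * ‖PowerSeries.coeff p.2 G‖ :=
        (hF.mul hG).tsum_le_tsum (norm_coeff_mul_le F G) (hF.summable_antidiagonal hG)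
    _ = absNorm F * absNorm G :=
        (tsum_mul_tsum_eq_tsum_sum_antidiagonal_of_summable_norm hF.norm hG.norm).symm

theorem absNorm_prod_le [NormOneClass R] {ι : Type*} (s : Finset ι) {F : ι → PowerSeries R}
    (h : ∀ i ∈ s, AbsSummable (F i)) : absNorm (∏ i ∈ s, F i) ≤ ∏ i ∈ s, absNorm (F i) := by
  classical
  induction s using Finset.induction_on with
  | empty => simp [absNorm_one]
  | insert i s hi ih =>
    rw [Finset.prod_insert hi, Finset.prod_insert hi]
    have hs : ∀ j ∈ s, AbsSummable (F j) := fun j hj => h j (Finset.mem_insert_of_mem hj)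
    exact ((h i (Finset.mem_insert_self i s)).absNorm_mul_le (prod s hs)).trans
      (mul_le_mul_of_nonneg_left (ih hs) (absNorm_nonneg _))

theorem coeffSum_mul [CompleteSpace R] (hF : AbsSummable F) (hG : AbsSummable G) :
    coeffSum (F * G) = coeffSum F * coeffSum G := by
  rw [coeffSum, coeffSum, coeffSum, tsum_mul_tsum_eq_tsum_sum_antidiagonal_of_summable_norm hF hG]
  exact tsum_congr fun n => PowerSeries.coeff_mul n F G

theorem coeffSum_prod [CompleteSpace R] {ι : Type*} (s : Finset ι) {F : ι → PowerSeries R}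
    (h : ∀ i ∈ s, AbsSummable (F i)) : coeffSum (∏ i ∈ s, F i) = ∏ i ∈ s, coeffSum (F i) := by
  classical
  induction s using Finset.induction_on with
  | empty => simp [coeffSum_one]
  | insert i s hi ih =>
    rw [Finset.prod_insert hi, Finset.prod_insert hi]
    have hs : ∀ j ∈ s, AbsSummable (F j) := fun j hj => h j (Finset.mem_insert_of_mem hj)
    rw [(h i (Finset.mem_insert_self i s)).coeffSum_mul (prod s hs), ih hs]

theorem absNorm_rescale_le [NormOneClass R] (hF : AbsSummable F)
    (hF₀ : PowerSeries.coeff 0 F = 1) (hF₁ : PowerSeries.coeff 1 F = 0) {x : R} (hx : ‖x‖ ≤ 1) :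
    absNorm (PowerSeries.rescale x F) ≤ 1 + ‖x‖ ^ 2 * absNorm F := by
  have hcoeff (n : ℕ) : ‖PowerSeries.coeff n (PowerSeries.rescale x F)‖ ≤
      (if n = 0 then 1 else 0) + ‖x‖ ^ 2 * ‖PowerSeries.coeff n F‖ := by
    rw [PowerSeries.coeff_rescale]
    match n with
    | 0 => simp [hF₀]
    | 1 => simp [hF₁]
    | n + 2 =>
      rw [if_neg (by omega), zero_add]
      refine (norm_mul_le _ _).trans (mul_le_mul_of_nonneg_right ?_ (norm_nonneg _))
      exact (norm_pow_le x _).trans (pow_le_pow_of_le_one (norm_nonneg _) hx (by omega))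
  have hmajorant : HasSum (fun n => (if n = 0 then 1 else 0) + ‖x‖ ^ 2 * ‖PowerSeries.coeff n F‖)
      (1 + ‖x‖ ^ 2 * absNorm F) := (hasSum_ite_eq 0 1).add (hF.hasSum.mul_left _)
  exact hasSum_le hcoeff (hF.rescale hx).hasSum hmajorant

end AbsSummable

end AbsSummable

theorem tendsto_coeffSum_rescale {F : ℕ → PowerSeries ℂ} {G : PowerSeries ℂ} {B : ℝ} {x : ℂ}
    (hx : ‖x‖ < 1) (hF : ∀ N n, ‖PowerSeries.coeff n (F N)‖ ≤ B)
    (hG : ∀ n, Tendsto (fun N => PowerSeries.coeff n (F N)) atTop (𝓝 (PowerSeries.coeff n G))) :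
    Tendsto (fun N => coeffSum (PowerSeries.rescale x (F N))) atTop
      (𝓝 (coeffSum (PowerSeries.rescale x G))) := by
  simp only [coeffSum, PowerSeries.coeff_rescale]
  refine tendsto_tsum_of_dominated_convergence (bound := fun n => ‖x‖ ^ n * B)
    ((summable_geometric_of_lt_one (norm_nonneg _) hx).mul_right _)
    (fun n => (hG n).const_mul _) (.of_forall fun N n => ?_)
  rw [norm_mul, norm_pow]
  exact mul_le_mul_of_nonneg_left (hF N n) (by positivity)

theorem hasSum_norm_coeff_letterSeries {a : ℕ+ → ℂ} (ha : Summable fun s => ‖a s‖) :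
    HasSum (fun n => ‖PowerSeries.coeff n (letterSeries a)‖) (1 + ∑' s, ‖a s‖) := by
  rw [← hasSum_nat_add_iff' 1]
  simp only [Finset.range_one, Finset.sum_singleton, coeff_zero_letterSeries, norm_one,
    add_sub_cancel_left]
  rw [← hasSum_pnat_iff_hasSum_succ (f := fun n => ‖PowerSeries.coeff n (letterSeries a)‖)]
  simpa only [coeff_letterSeries_pnat] using ha.hasSum

theorem absSummable_letterSeries_iff {a : ℕ+ → ℂ} :
    AbsSummable (letterSeries a) ↔ Summable fun s => ‖a s‖ := by
  refine ⟨fun ha => ?_, fun ha => (hasSum_norm_coeff_letterSeries ha).summable⟩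
  simpa only [Function.comp_def, coeff_letterSeries_pnat] using
    ha.comp_injective PNat.coe_injective

theorem absNorm_letterSeries {a : ℕ+ → ℂ} (ha : Summable fun s => ‖a s‖) :
    absNorm (letterSeries a) = 1 + ∑' s, ‖a s‖ :=
  (hasSum_norm_coeff_letterSeries ha).tsum_eq

/-- The power series `exp (x X)`. -/
def expSeries (x : ℂ) : PowerSeries ℂ := PowerSeries.rescale x (PowerSeries.exp ℂ)

theorem coeff_expSeries (x : ℂ) (n : ℕ) :
    PowerSeries.coeff n (expSeries x) = x ^ n / (n.factorial : ℂ) := by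
  simp [expSeries, PowerSeries.coeff_rescale, PowerSeries.coeff_exp, div_eq_mul_inv]

theorem expSeries_mul (x y : ℂ) : expSeries x * expSeries y = expSeries (x + y) :=
  PowerSeries.exp_mul_exp_eq_exp_add x y

theorem rescale_expSeries (x y : ℂ) :
    PowerSeries.rescale x (expSeries y) = expSeries (x * y) := by
  rw [expSeries, PowerSeries.rescale_rescale, mul_comm, expSeries]

theorem expSeries_zero : expSeries 0 = 1 := by
  simp [expSeries, PowerSeries.rescale_zero]

theorem expSeries_sum {ι : Type*} (s : Finset ι) (x : ι → ℂ) :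
    ∏ i ∈ s, expSeries (x i) = expSeries (∑ i ∈ s, x i) := by
  classical
  induction s using Finset.induction_on with
  | empty => simp [expSeries_zero]
  | insert i s hi ih => rw [Finset.prod_insert hi, Finset.sum_insert hi, ih, expSeries_mul]

theorem hasSum_norm_coeff_expSeries (x : ℂ) :
    HasSum (fun n => ‖PowerSeries.coeff n (expSeries x)‖) (Real.exp ‖x‖) := by
  rw [Real.exp_eq_exp_ℝ]
  simpa only [coeff_expSeries, norm_div, norm_pow, Complex.norm_natCast] using
    NormedSpace.expSeries_div_hasSum_exp ‖x‖

theorem absSummable_expSeries (x : ℂ) : AbsSummable (expSeries x) :=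
  (hasSum_norm_coeff_expSeries x).summable

theorem absNorm_expSeries (x : ℂ) : absNorm (expSeries x) = Real.exp ‖x‖ :=
  (hasSum_norm_coeff_expSeries x).tsum_eq

theorem coeffSum_expSeries (x : ℂ) : coeffSum (expSeries x) = Complex.exp x := by
  rw [Complex.exp_eq_exp_ℂ, coeffSum, ← (NormedSpace.expSeries_div_hasSum_exp x).tsum_eq]
  exact tsum_congr (coeff_expSeries x)

/-! ### Normalized products and absolute convergence of `γ` on stars -/

theorem norm_inv_succ (m : ℕ) : ‖((m : ℂ) + 1)⁻¹‖ = ((m : ℝ) + 1)⁻¹ := by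
  rw [norm_inv, norm_natCast_add_one]

theorem norm_inv_succ_le (m : ℕ) : ‖((m : ℂ) + 1)⁻¹‖ ≤ 1 := by
  rw [norm_inv_succ]
  exact inv_le_one_of_one_le₀ (by simp)

/-- The series `(1 + ∑ a_s X^s) exp (-a_1 X) = 1 + O(X²)`: the exponential factor makes the product
over `m` of its rescalings by `1 / (m + 1)` converge. -/
def normalizedSeries (a : ℕ+ → ℂ) : PowerSeries ℂ := letterSeries a * expSeries (-a 1)

/-- The partial products of the rescalings of `normalizedSeries a` by `1 / (m + 1)`. -/
def normalizedProd (a : ℕ+ → ℂ) (N : ℕ) : PowerSeries ℂ :=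
  ∏ m ∈ Finset.range N, PowerSeries.rescale ((m : ℂ) + 1)⁻¹ (normalizedSeries a)

/-- The coefficientwise limit of `normalizedProd a`, see `tendsto_coeff_normalizedProd`. -/
def normalizedLim (a : ℕ+ → ℂ) : PowerSeries ℂ :=
  gammaGen a * expSeries (-a 1 * Real.eulerMascheroniConstant)

theorem normalizedProd_eq (a : ℕ+ → ℂ) (N : ℕ) :
    normalizedProd a N = harmonicSeries a N * expSeries (-a 1 * harmonicSum [1] N) := by
  simp only [normalizedProd, normalizedSeries, map_mul, Finset.prod_mul_distrib, rescale_expSeries,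
    expSeries_sum, ← Finset.sum_mul, harmonicSeries]
  simp [harmonicSum, mul_comm]

theorem gammaGen_eq (a : ℕ+ → ℂ) :
    gammaGen a = normalizedLim a * expSeries (a 1 * Real.eulerMascheroniConstant) := by
  rw [normalizedLim, mul_assoc, expSeries_mul, neg_mul, neg_add_cancel, expSeries_zero, mul_one]

theorem hasLogExpansionCoeff_normalizedProd (a : ℕ+ → ℂ) :
    HasLogExpansionCoeff (normalizedProd a) (normalizedLim a) := by
  have hexp : HasLogExpansionCoeff (fun N => expSeries (-a 1 * harmonicSum [1] N))
      (expSeries (-a 1 * Real.eulerMascheroniConstant)) := by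
    intro n
    simp only [coeff_expSeries, div_eq_mul_inv]
    rw [← gammaWord_one]
    exact (((hasLogExpansion_gammaWord [1]).const_mul (-a 1)).pow n).mul (.const _)
  rw [normalizedLim, funext (normalizedProd_eq a)]
  exact (hasLogExpansionCoeff_harmonicSeries a).mul hexp

theorem coeff_zero_normalizedSeries (a : ℕ+ → ℂ) :
    PowerSeries.coeff 0 (normalizedSeries a) = 1 := by
  simp [normalizedSeries, PowerSeries.coeff_mul, coeff_zero_letterSeries, coeff_expSeries]

theorem coeff_one_normalizedSeries (a : ℕ+ → ℂ) :
    PowerSeries.coeff 1 (normalizedSeries a) = 0 := by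
  have hcoeff_one : PowerSeries.coeff 1 (letterSeries a) = a 1 := coeff_letterSeries_pnat a 1
  rw [normalizedSeries, PowerSeries.coeff_mul, Finset.Nat.antidiagonal_succ]
  simp [coeff_zero_letterSeries, coeff_expSeries, hcoeff_one]

theorem summable_inv_succ_sq : Summable fun m : ℕ => (((m : ℝ) + 1)⁻¹) ^ 2 := by
  have hshift := (summable_nat_add_iff 1).2 (Real.summable_nat_pow_inv.2 one_lt_two)
  exact hshift.congr fun m => by push_cast; rw [inv_pow]

/-- A bound for `absNorm (normalizedProd a N)`, uniform in `N`, when `∑ ‖a_s‖ ≤ M`. -/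
def normBound (M : ℝ) : ℝ :=
  Real.exp ((1 + M) * Real.exp M * ∑' m : ℕ, (((m : ℝ) + 1)⁻¹) ^ 2)

section Bounds

variable {a : ℕ+ → ℂ} {M : ℝ}

theorem absSummable_normalizedSeries (ha : Summable fun s => ‖a s‖) :
    AbsSummable (normalizedSeries a) :=
  (absSummable_letterSeries_iff.2 ha).mul (absSummable_expSeries _)

theorem norm_le_of_tsum_norm_le (ha : Summable fun s => ‖a s‖) (hM : ∑' s, ‖a s‖ ≤ M) (s : ℕ+) :
    ‖a s‖ ≤ M :=
  (ha.le_tsum s fun _ _ => norm_nonneg _).trans hM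

theorem absNorm_normalizedSeries_le (ha : Summable fun s => ‖a s‖) (hM : ∑' s, ‖a s‖ ≤ M) :
    absNorm (normalizedSeries a) ≤ (1 + M) * Real.exp M := by
  have hsum_nonneg : 0 ≤ ∑' s, ‖a s‖ := tsum_nonneg fun _ => norm_nonneg _
  have ha_one : ‖a 1‖ ≤ M := norm_le_of_tsum_norm_le ha hM 1
  calc absNorm (normalizedSeries a)
      ≤ absNorm (letterSeries a) * absNorm (expSeries (-a 1)) :=
        (absSummable_letterSeries_iff.2 ha).absNorm_mul_le (absSummable_expSeries _)
    _ = (1 + ∑' s, ‖a s‖) * Real.exp ‖a 1‖ := by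
        rw [absNorm_letterSeries ha, absNorm_expSeries, norm_neg]
    _ ≤ (1 + M) * Real.exp M := by
        refine mul_le_mul ?_ (Real.exp_le_exp.2 ha_one) (Real.exp_pos _).le ?_ <;> linarith

theorem absSummable_normalizedProd (ha : Summable fun s => ‖a s‖) (N : ℕ) :
    AbsSummable (normalizedProd a N) :=
  .prod _ fun m _ => (absSummable_normalizedSeries ha).rescale (norm_inv_succ_le m)

theorem absNorm_normalizedProd_le (ha : Summable fun s => ‖a s‖) (hM : ∑' s, ‖a s‖ ≤ M) (N : ℕ) :
    absNorm (normalizedProd a N) ≤ normBound M := by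
  have hM₀ : 0 ≤ M := (norm_nonneg (a 1)).trans (norm_le_of_tsum_norm_le ha hM 1)
  have hs := absSummable_normalizedSeries ha
  have hfactor (m : ℕ) : absNorm (PowerSeries.rescale ((m : ℂ) + 1)⁻¹ (normalizedSeries a)) ≤
      Real.exp ((1 + M) * Real.exp M * (((m : ℝ) + 1)⁻¹) ^ 2) := by
    refine (hs.absNorm_rescale_le (coeff_zero_normalizedSeries a) (coeff_one_normalizedSeries a)
      (norm_inv_succ_le m)).trans (le_trans ?_ (Real.add_one_le_exp _))
    rw [norm_inv_succ, add_comm, mul_comm]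
    have hnorm := absNorm_normalizedSeries_le ha hM
    gcongr
  calc absNorm (normalizedProd a N)
      ≤ ∏ m ∈ Finset.range N,
          absNorm (PowerSeries.rescale ((m : ℂ) + 1)⁻¹ (normalizedSeries a)) :=
        AbsSummable.absNorm_prod_le _ fun m _ => hs.rescale (norm_inv_succ_le m)
    _ ≤ ∏ m ∈ Finset.range N, Real.exp ((1 + M) * Real.exp M * (((m : ℝ) + 1)⁻¹) ^ 2) :=
        Finset.prod_le_prod (fun _ _ => absNorm_nonneg _) fun m _ => hfactor m
    _ ≤ normBound M := by
        rw [← Real.exp_sum, normBound, ← Finset.mul_sum]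
        gcongr
        exact summable_inv_succ_sq.sum_le_tsum _ fun _ _ => by positivity

theorem tendsto_coeff_normalizedProd (ha : Summable fun s => ‖a s‖) (n : ℕ) :
    Tendsto (fun N => PowerSeries.coeff n (normalizedProd a N)) atTop
      (𝓝 (PowerSeries.coeff n (normalizedLim a))) :=
  (hasLogExpansionCoeff_normalizedProd a n).tendsto_of_norm_le fun N =>
    ((absSummable_normalizedProd ha N).norm_coeff_le n).trans
      (absNorm_normalizedProd_le ha le_rfl N)

theorem sum_norm_coeff_normalizedLim_le (ha : Summable fun s => ‖a s‖) (hM : ∑' s, ‖a s‖ ≤ M)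
    (s : Finset ℕ) : ∑ n ∈ s, ‖PowerSeries.coeff n (normalizedLim a)‖ ≤ normBound M :=
  le_of_tendsto' (tendsto_finsetSum s fun n _ => (tendsto_coeff_normalizedProd ha n).norm) fun N =>
    ((absSummable_normalizedProd ha N).sum_le_tsum s fun _ _ => norm_nonneg _).trans
      (absNorm_normalizedProd_le ha hM N)

theorem absSummable_normalizedLim (ha : Summable fun s => ‖a s‖) :
    AbsSummable (normalizedLim a) :=
  summable_of_sum_le (fun _ => norm_nonneg _) (sum_norm_coeff_normalizedLim_le ha le_rfl)

theorem absNorm_normalizedLim_le (ha : Summable fun s => ‖a s‖) (hM : ∑' s, ‖a s‖ ≤ M) :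
    absNorm (normalizedLim a) ≤ normBound M :=
  (absSummable_normalizedLim ha).tsum_le_of_sum_le (sum_norm_coeff_normalizedLim_le ha hM)

theorem absSummable_gammaGen (ha : Summable fun s => ‖a s‖) : AbsSummable (gammaGen a) := by
  rw [gammaGen_eq]
  exact (absSummable_normalizedLim ha).mul (absSummable_expSeries _)

theorem absNorm_gammaGen_le (ha : Summable fun s => ‖a s‖) (hM : ∑' s, ‖a s‖ ≤ M) :
    absNorm (gammaGen a) ≤ normBound M * Real.exp (M * |Real.eulerMascheroniConstant|) := by
  have ha_one : ‖a 1‖ ≤ M := norm_le_of_tsum_norm_le ha hM 1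
  rw [gammaGen_eq]
  refine ((absSummable_normalizedLim ha).absNorm_mul_le (absSummable_expSeries _)).trans ?_
  rw [absNorm_expSeries, norm_mul, Complex.norm_real, Real.norm_eq_abs]
  refine mul_le_mul (absNorm_normalizedLim_le ha hM) ?_ (Real.exp_pos _).le (Real.exp_pos _).le
  gcongr

theorem tendsto_sum_gammaComponent (ha : AbsSummable (gammaGen a)) :
    Tendsto (fun N => ∑ n ∈ Finset.range N, gammaComponent (kleeneStar (letters a)) n) atTop
      (𝓝 (coeffSum (gammaGen a))) := by
  have hsummable : Summable fun n => PowerSeries.coeff n (gammaGen a) := .of_norm ha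
  simpa only [coeffSum, gammaGen, PowerSeries.coeff_mk] using hsummable.hasSum.tendsto_sum_nat

theorem kleeneStar_mem_gammaDom (ha : AbsSummable (gammaGen a)) :
    kleeneStar (letters a) ∈ gammaDom :=
  ⟨_, tendsto_sum_gammaComponent ha⟩

theorem gammaSeries_kleeneStar (ha : AbsSummable (gammaGen a)) :
    gammaSeries (kleeneStar (letters a)) = coeffSum (gammaGen a) :=
  (tendsto_sum_gammaComponent ha).limUnder_eq

end Bounds

/-! ### Operations on the coefficients of the letters -/

theorem summable_norm_starLaw {a b : ℕ+ → ℂ} (ha : Summable fun s => ‖a s‖)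
    (hb : Summable fun s => ‖b s‖) : Summable fun s => ‖starLaw a b s‖ := by
  rw [← absSummable_letterSeries_iff] at *
  rw [letterSeries_starLaw]
  exact ha.mul hb

theorem summable_norm_single (r : ℕ+) (c : ℂ) :
    Summable fun s => ‖(Pi.single r c : ℕ+ → ℂ) s‖ :=
  summable_of_ne_finset_zero (s := {r}) fun s hs => by
    rw [Pi.single_eq_of_ne (Finset.notMem_singleton.1 hs), norm_zero]

theorem letterSeries_injective : Function.Injective letterSeries := by
  intro a b h
  funext s
  rw [← coeff_letterSeries_pnat a s, h, coeff_letterSeries_pnat]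

theorem letterSeries_single (r : ℕ+) (c : ℂ) :
    letterSeries (Pi.single r c) = 1 + PowerSeries.monomial (r : ℕ) c := by
  ext n
  rcases Nat.eq_zero_or_pos n with rfl | hn
  · rw [coeff_zero_letterSeries, map_add, PowerSeries.coeff_monomial, if_neg r.ne_zero.symm,
      PowerSeries.coeff_zero_one, add_zero]
  · lift n to ℕ+ using hn
    simp [coeff_letterSeries_pnat, PowerSeries.coeff_one, PowerSeries.coeff_monomial,
      Pi.single_apply]

theorem letterSeries_add (a b : ℕ+ → ℂ) :
    letterSeries (a + b) = letterSeries a + letterSeries b - 1 := by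
  ext n
  rcases eq_or_ne n 0 with rfl | hn
  · simp only [map_add, map_sub, coeff_zero_letterSeries, PowerSeries.coeff_zero_one,
      add_sub_cancel_right]
  · simp [coeff_letterSeries_of_ne_zero _ hn, PowerSeries.coeff_one, hn]

theorem starLaw_single (r s : ℕ+) (c d : ℂ) :
    starLaw (Pi.single s c) (Pi.single r d) =
      Pi.single s c + Pi.single r d + Pi.single (s + r) (c * d) := by
  apply letterSeries_injective
  simp only [letterSeries_starLaw, letterSeries_add, letterSeries_single, PNat.add_coe,
    ← PowerSeries.monomial_mul_monomial]
  ring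

theorem starLaw_single_neg (s : ℕ+) (c : ℂ) :
    starLaw (Pi.single s c) (Pi.single s (-c)) = Pi.single (2 * s) (-c ^ 2) := by
  rw [starLaw_single, ← Pi.single_add, add_neg_cancel, Pi.single_zero, zero_add, mul_neg, ← sq,
    show s + s = 2 * s from PNat.coe_injective (two_mul (s : ℕ)).symm]

theorem kleeneStar_letters_pow_mul (x : ℂ) (a : ℕ+ → ℂ) (w : Word) :
    kleeneStar (letters fun s => x ^ (s : ℕ) * a s) w =
      x ^ weight w * kleeneStar (letters a) w := by
  induction w with
  | nil => simp [kleeneStar_letters_nil]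
  | cons s w ih =>
    rw [kleeneStar_letters_cons, kleeneStar_letters_cons, ih, weight_cons, pow_add]
    ring

theorem gammaGen_pow_mul (x : ℂ) (a : ℕ+ → ℂ) :
    gammaGen (fun s => x ^ (s : ℕ) * a s) = PowerSeries.rescale x (gammaGen a) := by
  ext n
  simp only [PowerSeries.coeff_rescale, gammaGen, PowerSeries.coeff_mk, gammaComponent,
    Finset.mul_sum]
  refine Finset.sum_congr rfl fun w hw => ?_
  rw [kleeneStar_letters_pow_mul, mem_wordsOfWeight.1 hw, mul_assoc]

theorem letterSeries_pow_mul (x : ℂ) (a : ℕ+ → ℂ) :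
    letterSeries (fun s => x ^ (s : ℕ) * a s) = PowerSeries.rescale x (letterSeries a) := by
  ext n
  rw [PowerSeries.coeff_rescale]
  rcases Nat.eq_zero_or_pos n with rfl | hn
  · simp [coeff_zero_letterSeries]
  · lift n to ℕ+ using hn
    rw [coeff_letterSeries_pnat, coeff_letterSeries_pnat]

theorem pow_mul_single (x c : ℂ) (r : ℕ+) :
    (fun s : ℕ+ => x ^ (s : ℕ) * (Pi.single r c : ℕ+ → ℂ) s) =
      Pi.single r (x ^ (r : ℕ) * c) := by
  funext s
  obtain rfl | hs := eq_or_ne s r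
  · simp
  · simp [hs]

/-! ### The functions `ell` -/

/-- The value `ζ(n)`, with Euler's constant in place of the pole at `n = 1`. With it, the two cases
in the definition of `ell` become one series, see `ell_eq_neg_tsum`. -/
def zetaReg (n : ℕ) : ℂ := if n = 1 then (Real.eulerMascheroniConstant : ℂ) else riemannZeta n

/-- A bound for the values `zetaReg n`, `n ≥ 1`. -/
def zetaRegBound : ℝ := |Real.eulerMascheroniConstant| + ∑' m : ℕ, (((m : ℝ) + 1)⁻¹) ^ 2

theorem hasSum_inv_succ_pow {k : ℕ} (hk : 1 < k) :
    HasSum (fun m : ℕ => ((m : ℂ) + 1)⁻¹ ^ k) (riemannZeta k) := by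
  have hsummable : Summable fun n : ℕ => 1 / (n : ℂ) ^ k :=
    .of_norm (by simpa using Real.summable_nat_pow_inv.2 hk)
  have hsum := hsummable.hasSum
  rw [← zeta_nat_eq_tsum_of_gt_one hk, ← hasSum_nat_add_iff' 1] at hsum
  simpa [(zero_lt_one.trans hk).ne'] using hsum

theorem norm_inv_succ_pow_le {n : ℕ} (hn : 2 ≤ n) (m : ℕ) :
    ‖((m : ℂ) + 1)⁻¹ ^ n‖ ≤ (((m : ℝ) + 1)⁻¹) ^ 2 := by
  rw [norm_pow, ← norm_inv_succ]
  exact pow_le_pow_of_le_one (norm_nonneg _) (norm_inv_succ_le m) hn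

theorem zetaRegBound_nonneg : 0 ≤ zetaRegBound :=
  add_nonneg (abs_nonneg _) (tsum_nonneg fun _ => by positivity)

theorem norm_zetaReg_le {n : ℕ} (hn : 1 ≤ n) : ‖zetaReg n‖ ≤ zetaRegBound := by
  rw [zetaReg, zetaRegBound]
  split_ifs with h
  · rw [Complex.norm_real, Real.norm_eq_abs]
    exact le_add_of_nonneg_right (tsum_nonneg fun _ => by positivity)
  · rw [← (hasSum_inv_succ_pow (by omega : 1 < n)).tsum_eq]
    exact le_add_of_nonneg_of_le (abs_nonneg _) (tsum_of_norm_bounded summable_inv_succ_sq.hasSum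
      (norm_inv_succ_pow_le (by omega)))

/-- The terms of the power series of `-ell r`. -/
def ellTerm (r : ℕ+) (z : ℂ) (k : ℕ) : ℂ :=
  zetaReg (r * (k + 1)) * (-z ^ (r : ℕ)) ^ (k + 1) / ((k : ℂ) + 1)

theorem norm_ellTerm_le (r : ℕ+) {z : ℂ} {ρ : ℝ} (hz : ‖z‖ ≤ ρ) (hρ : ρ ≤ 1) (k : ℕ) :
    ‖ellTerm r z k‖ ≤ zetaRegBound * ρ ^ (r : ℕ) * ρ ^ k := by
  have hρ₀ : 0 ≤ ρ := (norm_nonneg z).trans hz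
  have hpow : ‖(-z ^ (r : ℕ)) ^ (k + 1)‖ ≤ ρ ^ (r : ℕ) * ρ ^ k := by
    rw [norm_pow, norm_neg, norm_pow, ← pow_mul, ← pow_add]
    refine (pow_le_pow_left₀ (norm_nonneg z) hz _).trans (pow_le_pow_of_le_one hρ₀ hρ ?_)
    nlinarith [r.pos]
  rw [ellTerm, norm_div, norm_mul, norm_natCast_add_one, mul_assoc]
  refine (div_le_self (by positivity) (by simp)).trans ?_
  exact mul_le_mul (norm_zetaReg_le (Nat.mul_pos r.pos k.succ_pos)) hpow (norm_nonneg _)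
    zetaRegBound_nonneg

theorem summable_ellTerm (r : ℕ+) {z : ℂ} (hz : ‖z‖ < 1) : Summable (ellTerm r z) :=
  .of_norm_bounded ((summable_geometric_of_lt_one (norm_nonneg z) hz).mul_left _)
    (norm_ellTerm_le r le_rfl hz.le)

theorem ell_eq_neg_tsum (r : ℕ+) {z : ℂ} (hz : ‖z‖ < 1) : ell r z = -∑' k, ellTerm r z k := by
  obtain rfl | hr := eq_or_ne r 1
  · rw [(summable_ellTerm 1 hz).tsum_eq_zero_add, ell, if_pos rfl]
    simp only [ellTerm, zetaReg, PNat.one_coe, one_mul, pow_one, zero_add, if_true,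
      Nat.add_eq_right, Nat.add_eq_zero_iff, one_ne_zero, and_false, if_false]
    push_cast
    simp only [add_assoc, one_add_one_eq_two]
    ring
  · rw [ell, if_neg hr]
    congr 1
    refine tsum_congr fun k => ?_
    have hone : (r : ℕ) * (k + 1) ≠ 1 := fun h =>
      hr (PNat.coe_injective (Nat.eq_one_of_dvd_one (Dvd.intro _ h)))
    rw [ellTerm, zetaReg, if_neg hone]
    push_cast
    rw [mul_comm ((r : ℕ) : ℂ)]

theorem hasSum_neg_ellTerm (r : ℕ+) {z : ℂ} (hz : ‖z‖ < 1) :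
    HasSum (fun k => -ellTerm r z k) (ell r z) := by
  rw [ell_eq_neg_tsum r hz]
  exact (summable_ellTerm r hz).hasSum.neg

/-- The constant in the bound `norm_ell_le` of the functions `ell r` on the disc of radius `ρ`. -/
def ellBound (ρ : ℝ) : ℝ := zetaRegBound / (1 - ρ)

theorem norm_ell_le {ρ : ℝ} (hρ : ρ < 1) (r : ℕ+) {z : ℂ} (hz : ‖z‖ ≤ ρ) :
    ‖ell r z‖ ≤ ellBound ρ * ρ ^ (r : ℕ) := by
  have hgeom := hasSum_geometric_of_lt_one ((norm_nonneg z).trans hz) hρ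
  rw [ell_eq_neg_tsum r (hz.trans_lt hρ), norm_neg]
  refine (tsum_of_norm_bounded (hgeom.mul_left _) (norm_ellTerm_le r hz hρ.le)).trans_eq ?_
  rw [ellBound, div_eq_mul_inv, mul_right_comm]

theorem differentiableOn_tsum_of_summable_on_balls {ι E : Type*} [NormedAddCommGroup E]
    [NormedSpace ℂ E] [CompleteSpace E] {F : ι → ℂ → E} {u : ℝ → ι → ℝ}
    (hu : ∀ ρ, 0 ≤ ρ → ρ < 1 → Summable (u ρ))
    (hF : ∀ i, DifferentiableOn ℂ (F i) (Metric.ball 0 1))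
    (hle : ∀ ρ, ρ < 1 → ∀ i z, ‖z‖ ≤ ρ → ‖F i z‖ ≤ u ρ i) :
    DifferentiableOn ℂ (fun z => ∑' i, F i z) (Metric.ball 0 1) := by
  intro z hz
  obtain ⟨ρ, hzρ, hρ⟩ := exists_between (mem_ball_zero_iff.1 hz)
  have hball : DifferentiableOn ℂ (fun z => ∑' i, F i z) (Metric.ball 0 ρ) :=
    Complex.differentiableOn_tsum_of_summable_norm (hu ρ ((norm_nonneg z).trans hzρ.le) hρ)
      (fun i => (hF i).mono (Metric.ball_subset_ball hρ.le)) Metric.isOpen_ball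
      fun i w hw => hle ρ hρ i w (mem_ball_zero_iff.1 hw).le
  exact (hball.differentiableAt
    (Metric.isOpen_ball.mem_nhds (mem_ball_zero_iff.2 hzρ))).differentiableWithinAt

theorem differentiableOn_ell (r : ℕ+) : DifferentiableOn ℂ (ell r) (Metric.ball 0 1) := by
  refine DifferentiableOn.congr (f := fun z => -∑' k, ellTerm r z k) ?_ fun z hz =>
    ell_eq_neg_tsum r (mem_ball_zero_iff.1 hz)
  refine (differentiableOn_tsum_of_summable_on_balls (F := fun k z => ellTerm r z k)
    (fun ρ hρ₀ hρ₁ => (summable_geometric_of_lt_one hρ₀ hρ₁).mul_left _) (fun k => ?_)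
    fun ρ hρ₁ k z hz => norm_ellTerm_le r hz hρ₁.le k).neg
  unfold ellTerm
  fun_prop

theorem summable_pow_pnat {ρ : ℝ} (hρ₀ : 0 ≤ ρ) (hρ₁ : ρ < 1) :
    Summable fun r : ℕ+ => ρ ^ (r : ℕ) :=
  (summable_geometric_of_lt_one hρ₀ hρ₁).comp_injective PNat.coe_injective

/-- The sum `∑_{r ≥ 1} ℓ_r`. -/
def ellSum (z : ℂ) : ℂ := ∑' r : ℕ+, ell r z

theorem hasSum_ell {z : ℂ} (hz : ‖z‖ < 1) : HasSum (fun r => ell r z) (ellSum z) :=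
  (Summable.of_norm_bounded ((summable_pow_pnat (norm_nonneg z) hz).mul_left (ellBound ‖z‖))
    fun r => norm_ell_le hz r le_rfl).hasSum

theorem differentiableOn_ellSum : DifferentiableOn ℂ ellSum (Metric.ball 0 1) :=
  differentiableOn_tsum_of_summable_on_balls
    (fun _ hρ₀ hρ₁ => (summable_pow_pnat hρ₀ hρ₁).mul_left _) differentiableOn_ell
    fun _ hρ₁ r _ hz => norm_ell_le hρ₁ r hz

theorem hasSum_deriv_ell {z : ℂ} (hz : ‖z‖ < 1) :
    HasSum (fun r => deriv (ell r) z) (deriv ellSum z) := by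
  obtain ⟨ρ, hzρ, hρ⟩ := exists_between hz
  exact Complex.hasSum_deriv_of_summable_norm
    ((summable_pow_pnat ((norm_nonneg z).trans hzρ.le) hρ).mul_left (ellBound ρ))
    (fun r => (differentiableOn_ell r).mono (Metric.ball_subset_ball hρ.le)) Metric.isOpen_ball
    (fun r w hw => norm_ell_le hρ r (mem_ball_zero_iff.1 hw).le) (mem_ball_zero_iff.2 hzρ)

theorem ell_zero (r : ℕ+) : ell r 0 = 0 := by
  simpa using norm_ell_le zero_lt_one r (z := 0) (by simp)

theorem ellSum_zero : ellSum 0 = 0 := by simp [ellSum, ell_zero]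

/-! ### The value of `γ` on the star of a letter -/

theorem norm_mul_inv_succ_le (z : ℂ) (m : ℕ) : ‖z * ((m : ℂ) + 1)⁻¹‖ ≤ ‖z‖ := by
  rw [norm_mul]
  exact mul_le_of_le_one_right (norm_nonneg z) (norm_inv_succ_le m)

theorem norm_mul_inv_succ_pow_lt_one (r : ℕ+) {z : ℂ} (hz : ‖z‖ < 1) (m : ℕ) :
    ‖(z * ((m : ℂ) + 1)⁻¹) ^ (r : ℕ)‖ < 1 := by
  rw [norm_pow]
  exact pow_lt_one₀ (norm_nonneg _) ((norm_mul_inv_succ_le z m).trans_lt hz) r.ne_zero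

/-- The terms of the series `∑_k -(-w^r)^(k+1) / (k+1)` of `log (1 + w^r)` at `w = z / (m + 1)`,
from which the term linear in `w`, present for `r = 1` only, is removed in order to make the double
series over `k` and `m` converge. -/
def logTerm (r : ℕ+) (z : ℂ) (k m : ℕ) : ℂ :=
  -(-(z * ((m : ℂ) + 1)⁻¹) ^ (r : ℕ)) ^ (k + 1) / ((k : ℂ) + 1) -
    if k = 0 then (Pi.single r 1 : ℕ+ → ℂ) 1 * (z * ((m : ℂ) + 1)⁻¹) else 0

theorem logTerm_one_zero (z : ℂ) (m : ℕ) : logTerm 1 z 0 m = 0 := by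
  simp [logTerm]

theorem ite_single_mul_eq_zero {r : ℕ+} {k : ℕ} (h : (r : ℕ) * (k + 1) ≠ 1) (x : ℂ) :
    (if k = 0 then (Pi.single r 1 : ℕ+ → ℂ) 1 * x else 0) = 0 := by
  refine ite_eq_right_iff.2 fun hk => ?_
  have hr : r ≠ 1 := fun hr => h (by simp [hr, hk])
  rw [Pi.single_eq_of_ne hr.symm, zero_mul]

theorem logTerm_of_ne {r : ℕ+} {k : ℕ} (h : (r : ℕ) * (k + 1) ≠ 1) (z : ℂ) (m : ℕ) :
    logTerm r z k m =
      ((m : ℂ) + 1)⁻¹ ^ ((r : ℕ) * (k + 1)) * (-(-z ^ (r : ℕ)) ^ (k + 1) / ((k : ℂ) + 1)) := by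
  rw [logTerm, ite_single_mul_eq_zero h, sub_zero, mul_pow, ← neg_mul, mul_pow, ← pow_mul]
  ring

theorem norm_logTerm_le (r : ℕ+) {z : ℂ} (hz : ‖z‖ ≤ 1) (k m : ℕ) :
    ‖logTerm r z k m‖ ≤ ‖z‖ ^ k * (((m : ℝ) + 1)⁻¹) ^ 2 := by
  by_cases h : (r : ℕ) * (k + 1) = 1
  · obtain rfl : r = 1 := PNat.coe_injective (Nat.eq_one_of_dvd_one (Dvd.intro _ h))
    obtain rfl : k = 0 := by simpa using h
    rw [logTerm_one_zero, norm_zero]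
    positivity
  · have htwo : 2 ≤ (r : ℕ) * (k + 1) := by
      have : 0 < (r : ℕ) * (k + 1) := Nat.mul_pos r.pos k.succ_pos
      omega
    have hk : k ≤ (r : ℕ) * (k + 1) := by nlinarith [r.pos]
    rw [logTerm_of_ne h, norm_mul, mul_comm]
    refine mul_le_mul ?_ (norm_inv_succ_pow_le htwo m) (norm_nonneg _) (by positivity)
    rw [norm_div, norm_neg, norm_pow, norm_neg, norm_pow, ← pow_mul, norm_natCast_add_one]
    exact (div_le_self (by positivity) (by simp)).trans
      (pow_le_pow_of_le_one (norm_nonneg z) hz hk)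

theorem summable_logTerm (r : ℕ+) {z : ℂ} (hz : ‖z‖ < 1) :
    Summable fun p : ℕ × ℕ => logTerm r z p.1 p.2 :=
  .of_norm_bounded
    ((summable_geometric_of_lt_one (norm_nonneg z) hz).mul_of_nonneg summable_inv_succ_sq
      (fun _ => by positivity) fun _ => by positivity)
    fun p => norm_logTerm_le r hz.le p.1 p.2

theorem hasSum_logTerm_left (r : ℕ+) {z : ℂ} (hz : ‖z‖ < 1) (m : ℕ) :
    HasSum (fun k => logTerm r z k m) (Complex.log (1 + (z * ((m : ℂ) + 1)⁻¹) ^ (r : ℕ)) -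
      (Pi.single r 1 : ℕ+ → ℂ) 1 * (z * ((m : ℂ) + 1)⁻¹)) := by
  have hlog := Complex.hasSum_taylorSeries_log (norm_mul_inv_succ_pow_lt_one r hz m)
  rw [← hasSum_nat_add_iff' 1] at hlog
  simp only [Finset.range_one, Finset.sum_singleton, Nat.cast_zero, div_zero, sub_zero] at hlog
  refine (hlog.congr_fun fun k => ?_).sub (hasSum_ite_eq 0 _)
  rw [neg_pow, pow_succ (-1 : ℂ) (k + 1)]
  push_cast
  ring

theorem hasSum_logTerm_right (r : ℕ+) (z : ℂ) (k : ℕ) :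
    HasSum (fun m => logTerm r z k m) (-ellTerm r z k -
      if k = 0 then (Pi.single r 1 : ℕ+ → ℂ) 1 * (Real.eulerMascheroniConstant * z) else 0) := by
  by_cases h : (r : ℕ) * (k + 1) = 1
  · obtain rfl : r = 1 := PNat.coe_injective (Nat.eq_one_of_dvd_one (Dvd.intro _ h))
    obtain rfl : k = 0 := by simpa using h
    simp [logTerm_one_zero, ellTerm, zetaReg]
  · have hone : 1 < (r : ℕ) * (k + 1) :=
      lt_of_le_of_ne (Nat.mul_pos r.pos k.succ_pos) (Ne.symm h)
    rw [ite_single_mul_eq_zero h, sub_zero, ellTerm, zetaReg, if_neg h, mul_div_assoc, ← mul_neg,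
      ← neg_div]
    simpa only [logTerm_of_ne h] using (hasSum_inv_succ_pow hone).mul_right _

theorem hasSum_log_sub_ell (r : ℕ+) {z : ℂ} (hz : ‖z‖ < 1) :
    HasSum (fun m : ℕ => Complex.log (1 + (z * ((m : ℂ) + 1)⁻¹) ^ (r : ℕ)) -
        (Pi.single r 1 : ℕ+ → ℂ) 1 * (z * ((m : ℂ) + 1)⁻¹))
      (ell r z - (Pi.single r 1 : ℕ+ → ℂ) 1 * (Real.eulerMascheroniConstant * z)) := by
  have hdouble := (summable_logTerm r hz).hasSum
  have hright := hdouble.prod_fiberwise (hasSum_logTerm_right r z)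
  rw [← hright.unique ((hasSum_neg_ellTerm r hz).sub (hasSum_ite_eq 0 _))]
  exact ((Equiv.prodComm ℕ ℕ).hasSum_iff.2 hdouble).prod_fiberwise (hasSum_logTerm_left r hz)

theorem coeffSum_letterSeries_single (r : ℕ+) (c : ℂ) :
    coeffSum (letterSeries (Pi.single r c)) = 1 + c := by
  have hmonomial : HasSum (fun n => PowerSeries.coeff n (PowerSeries.monomial (r : ℕ) c)) c := by
    simpa only [PowerSeries.coeff_monomial] using hasSum_ite_eq (r : ℕ) c
  have hone : HasSum (fun n => PowerSeries.coeff n (1 : PowerSeries ℂ)) 1 := by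
    simpa only [PowerSeries.coeff_one] using hasSum_ite_eq 0 (1 : ℂ)
  simpa only [letterSeries_single, coeffSum, map_add] using (hone.add hmonomial).tsum_eq

theorem coeffSum_rescale_normalizedSeries_single (r : ℕ+) (x : ℂ) :
    coeffSum (PowerSeries.rescale x (normalizedSeries (Pi.single r 1))) =
      (1 + x ^ (r : ℕ)) * Complex.exp (-((Pi.single r 1 : ℕ+ → ℂ) 1 * x)) := by
  rw [normalizedSeries, map_mul, ← letterSeries_pow_mul, pow_mul_single, rescale_expSeries, mul_one,
    (absSummable_letterSeries_iff.2 (summable_norm_single _ _)).coeffSum_mul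
      (absSummable_expSeries _), coeffSum_letterSeries_single, coeffSum_expSeries, mul_neg,
    mul_comm x]

theorem coeffSum_rescale_normalizedProd_single (r : ℕ+) {z : ℂ} (hz : ‖z‖ < 1) (N : ℕ) :
    coeffSum (PowerSeries.rescale z (normalizedProd (Pi.single r 1) N)) =
      Complex.exp (∑ m ∈ Finset.range N, (Complex.log (1 + (z * ((m : ℂ) + 1)⁻¹) ^ (r : ℕ)) -
        (Pi.single r 1 : ℕ+ → ℂ) 1 * (z * ((m : ℂ) + 1)⁻¹))) := by
  simp only [normalizedProd, map_prod, PowerSeries.rescale_rescale, mul_comm _ z]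
  rw [AbsSummable.coeffSum_prod _ fun m _ => (absSummable_normalizedSeries
    (summable_norm_single r 1)).rescale ((norm_mul_inv_succ_le z m).trans hz.le), Complex.exp_sum]
  refine Finset.prod_congr rfl fun m _ => ?_
  rw [coeffSum_rescale_normalizedSeries_single, sub_eq_add_neg, Complex.exp_add,
    Complex.exp_log (Complex.slitPlane_ne_zero
      (Complex.mem_slitPlane_of_norm_lt_one (norm_mul_inv_succ_pow_lt_one r hz m)))]

theorem coeffSum_rescale_normalizedLim_single (r : ℕ+) {z : ℂ} (hz : ‖z‖ < 1) :
    coeffSum (PowerSeries.rescale z (normalizedLim (Pi.single r 1))) = Complex.exp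
      (ell r z - (Pi.single r 1 : ℕ+ → ℂ) 1 * (Real.eulerMascheroniConstant * z)) := by
  have ha := summable_norm_single r 1
  refine tendsto_nhds_unique (tendsto_coeffSum_rescale hz (fun N n =>
    ((absSummable_normalizedProd ha N).norm_coeff_le n).trans
      (absNorm_normalizedProd_le ha le_rfl N)) (tendsto_coeff_normalizedProd ha)) ?_
  simp only [coeffSum_rescale_normalizedProd_single r hz]
  exact (Complex.continuous_exp.tendsto _).comp (hasSum_log_sub_ell r hz).tendsto_sum_nat

theorem coeffSum_gammaGen_single (r : ℕ+) {z : ℂ} (hz : ‖z‖ < 1) :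
    coeffSum (gammaGen (Pi.single r (z ^ (r : ℕ)))) = Complex.exp (ell r z) := by
  have hlim := (absSummable_normalizedLim (summable_norm_single r 1)).rescale hz.le
  have hrescale : gammaGen (Pi.single r (z ^ (r : ℕ))) =
      PowerSeries.rescale z (gammaGen (Pi.single r 1)) := by
    rw [← gammaGen_pow_mul, pow_mul_single, mul_one]
  rw [hrescale, gammaGen_eq, map_mul, rescale_expSeries,
    hlim.coeffSum_mul (absSummable_expSeries _), coeffSum_rescale_normalizedLim_single r hz,
    coeffSum_expSeries, ← Complex.exp_add]
  ring_nf

theorem gammaSeries_single (r : ℕ+) {z : ℂ} (hz : ‖z‖ < 1) :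
    gammaSeries (kleeneStar (letters (Pi.single r (z ^ (r : ℕ))))) = Complex.exp (ell r z) := by
  rw [gammaSeries_kleeneStar (absSummable_gammaGen (summable_norm_single _ _)),
    coeffSum_gammaGen_single r hz]

/-! ### Infinite quasi-shuffle products -/

theorem letterSeries_zero : letterSeries 0 = 1 := by
  simpa using letterSeries_single 1 0

theorem harmonicSeries_zero (N : ℕ) : harmonicSeries 0 N = 1 := by
  simp [harmonicSeries, letterSeries_zero]

theorem gammaGen_zero : gammaGen 0 = 1 := by
  refine (hasLogExpansionCoeff_harmonicSeries 0).unique fun n => ?_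
  simpa only [harmonicSeries_zero] using HasLogExpansion.const _

theorem letterSeries_starLawProd (c : ℕ+ → ℂ) (k : ℕ) : letterSeries (starLawProd c k) =
    ∏ r ∈ Finset.range k, letterSeries (Pi.single r.succPNat (c r.succPNat)) := by
  induction k with
  | zero => simp [starLawProd, letterSeries_zero]
  | succ k ih => rw [starLawProd, letterSeries_starLaw, ih, Finset.prod_range_succ]

theorem summable_norm_starLawProd (c : ℕ+ → ℂ) (k : ℕ) :
    Summable fun s => ‖starLawProd c k s‖ := by
  induction k with
  | zero => simp [starLawProd]
  | succ k ih => exact summable_norm_starLaw ih (summable_norm_single _ _)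

theorem absNorm_letterSeries_single (r : ℕ+) (c : ℂ) :
    absNorm (letterSeries (Pi.single r c)) = 1 + ‖c‖ := by
  rw [absNorm_letterSeries (summable_norm_single r c), tsum_eq_single r fun s hs => by
    rw [Pi.single_eq_of_ne hs, norm_zero], Pi.single_eq_same]

theorem tsum_norm_starLawProd_le {c : ℕ+ → ℂ} (hc : Summable fun s => ‖c s‖) (k : ℕ) :
    ∑' s, ‖starLawProd c k s‖ ≤ Real.exp (∑' s, ‖c s‖) :=
  calc ∑' s, ‖starLawProd c k s‖
      ≤ absNorm (letterSeries (starLawProd c k)) := by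
        rw [absNorm_letterSeries (summable_norm_starLawProd c k)]
        exact le_add_of_nonneg_left zero_le_one
    _ ≤ ∏ r ∈ Finset.range k, (1 + ‖c r.succPNat‖) := by
        rw [letterSeries_starLawProd]
        exact (AbsSummable.absNorm_prod_le _ fun r _ =>
          absSummable_letterSeries_iff.2 (summable_norm_single _ _)).trans_eq
            (Finset.prod_congr rfl fun r _ => absNorm_letterSeries_single _ _)
    _ ≤ Real.exp (∑ r ∈ Finset.range k, ‖c r.succPNat‖) := by
        rw [Real.exp_sum]
        gcongr with r _
        rw [add_comm]
        exact Real.add_one_le_exp _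
    _ ≤ Real.exp (∑' s, ‖c s‖) := by
        gcongr
        exact ((hc.comp_injective Nat.succPNat_injective).sum_le_tsum _
          fun _ _ => norm_nonneg _).trans
            (tsum_comp_le_tsum_of_inj hc (fun _ => norm_nonneg _) Nat.succPNat_injective)

theorem tendsto_starLawProd (c : ℕ+ → ℂ) (s : ℕ+) :
    Tendsto (fun k => starLawProd c k s) atTop (𝓝 (starLawLim c s)) :=
  tendsto_atTop_of_eventually_const fun _ hk => starLawProd_apply_of_le c s hk

theorem summable_norm_starLawLim {c : ℕ+ → ℂ} (hc : Summable fun s => ‖c s‖) :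
    Summable fun s => ‖starLawLim c s‖ :=
  summable_of_sum_le (fun _ => norm_nonneg _) fun t =>
    le_of_tendsto' (tendsto_finsetSum t fun s _ => (tendsto_starLawProd c s).norm) fun k =>
      ((summable_norm_starLawProd c k).sum_le_tsum t fun _ _ => norm_nonneg _).trans
        (tsum_norm_starLawProd_le hc k)

theorem coeff_gammaGen_starLawProd (c : ℕ+ → ℂ) {n k : ℕ} (hk : n ≤ k) :
    PowerSeries.coeff n (gammaGen (starLawProd c k)) =
      PowerSeries.coeff n (gammaGen (starLawLim c)) := by
  simp only [gammaGen, PowerSeries.coeff_mk, gammaComponent]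
  refine Finset.sum_congr rfl fun w hw => ?_
  have hwk : weight w ≤ k := (mem_wordsOfWeight.1 hw).trans_le hk
  rw [kleeneStar_letters_congr fun s hs => starLawProd_apply_of_le c s (hs.trans hwk)]
  rfl

theorem starLawProd_pow_mul (x : ℂ) (c : ℕ+ → ℂ) (k : ℕ) :
    starLawProd (fun s => x ^ (s : ℕ) * c s) k = fun s : ℕ+ => x ^ (s : ℕ) * starLawProd c k s := by
  apply letterSeries_injective
  simp only [letterSeries_pow_mul, letterSeries_starLawProd, map_prod, ← pow_mul_single]

theorem starLawLim_pow_mul (x : ℂ) (c : ℕ+ → ℂ) :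
    starLawLim (fun s => x ^ (s : ℕ) * c s) = fun s : ℕ+ => x ^ (s : ℕ) * starLawLim c s :=
  funext fun s => congrFun (starLawProd_pow_mul x c s) s

theorem tendsto_coeffSum_gammaGen_starLawProd {c : ℕ+ → ℂ} (hc : Summable fun s => ‖c s‖) {x : ℂ}
    (hx : ‖x‖ < 1) :
    Tendsto (fun k => coeffSum (gammaGen (starLawProd (fun s => x ^ (s : ℕ) * c s) k))) atTop
      (𝓝 (coeffSum (gammaGen (starLawLim fun s => x ^ (s : ℕ) * c s)))) := by
  simp only [starLawProd_pow_mul, starLawLim_pow_mul, gammaGen_pow_mul]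
  have hprod := summable_norm_starLawProd c
  exact tendsto_coeffSum_rescale hx
    (fun k n => ((absSummable_gammaGen (hprod k)).norm_coeff_le n).trans
      (absNorm_gammaGen_le (hprod k) (tsum_norm_starLawProd_le hc k)))
    fun n => tendsto_atTop_of_eventually_const fun _ hk => coeff_gammaGen_starLawProd c hk

theorem coeffSum_gammaGen_starLawProd (c : ℕ+ → ℂ) (k : ℕ) :
    coeffSum (gammaGen (starLawProd c k)) =
      ∏ r ∈ Finset.range k, coeffSum (gammaGen (Pi.single r.succPNat (c r.succPNat))) := by
  induction k with
  | zero => rw [starLawProd, gammaGen_zero, coeffSum_one, Finset.prod_range_zero]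
  | succ k ih =>
    rw [starLawProd, gammaGen_starLaw, (absSummable_gammaGen
      (summable_norm_starLawProd c k)).coeffSum_mul (absSummable_gammaGen
      (summable_norm_single _ _)), ih, Finset.prod_range_succ]

theorem exists_mul_ofReal_eq {z : ℂ} (hz : ‖z‖ < 1) :
    ∃ (x : ℂ) (ρ : ℝ), ‖x‖ < 1 ∧ 0 < ρ ∧ ρ < 1 ∧ x * ρ = z := by
  obtain ⟨ρ, hzρ, hρ⟩ := exists_between hz
  have hρ₀ : 0 < ρ := (norm_nonneg z).trans_lt hzρ
  refine ⟨z / ρ, ρ, ?_, hρ₀, hρ, div_mul_cancel₀ z (Complex.ofReal_ne_zero.2 hρ₀.ne')⟩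
  rw [norm_div, Complex.norm_real, Real.norm_of_nonneg hρ₀.le]
  exact (div_lt_one hρ₀).2 hzρ

theorem summable_norm_pow_pnat {x : ℂ} (hx : ‖x‖ < 1) : Summable fun s : ℕ+ => ‖x ^ (s : ℕ)‖ := by
  simpa only [norm_pow] using summable_pow_pnat (norm_nonneg x) hx

theorem coeffSum_gammaGen_starLawLim_pow {z : ℂ} (hz : ‖z‖ < 1) :
    coeffSum (gammaGen (starLawLim fun r => z ^ (r : ℕ))) = Complex.exp (ellSum z) := by
  obtain ⟨x, ρ, hx, hρ₀, hρ₁, hxρ⟩ := exists_mul_ofReal_eq hz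
  have hρ : ‖(ρ : ℂ)‖ < 1 := by rwa [Complex.norm_real, Real.norm_of_nonneg hρ₀.le]
  have hlim := tendsto_coeffSum_gammaGen_starLawProd (summable_norm_pow_pnat hρ) hx
  simp only [← mul_pow, hxρ] at hlim
  have hsum : HasSum (fun r : ℕ => ell r.succPNat z) (ellSum z) :=
    (Equiv.pnatEquivNat.symm.hasSum_iff (f := fun r => ell r z)).2 (hasSum_ell hz)
  refine tendsto_nhds_unique hlim
    (((Complex.continuous_exp.tendsto _).comp hsum.tendsto_sum_nat).congr fun k => ?_)
  simp only [Function.comp_apply, Complex.exp_sum, coeffSum_gammaGen_starLawProd,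
    coeffSum_gammaGen_single _ hz]

theorem absSummable_gammaGen_starLawLim_pow {z : ℂ} (hz : ‖z‖ < 1) :
    AbsSummable (gammaGen (starLawLim fun r => z ^ (r : ℕ))) :=
  absSummable_gammaGen (summable_norm_starLawLim (summable_norm_pow_pnat hz))

theorem gammaSeries_starLawLim_pow {z : ℂ} (hz : ‖z‖ < 1) :
    gammaSeries (kleeneStar (letters (starLawLim fun r => z ^ (r : ℕ)))) =
      Complex.exp (ellSum z) := by
  rw [gammaSeries_kleeneStar (absSummable_gammaGen_starLawLim_pow hz),
    coeffSum_gammaGen_starLawLim_pow hz]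

/-! ### Iterated integrals -/

section Words

variable {ι : Type*}

theorem hasSum_list_of_hasSum_cons {E : Type*} [NormedAddCommGroup E] {f : List ι → E} {x : E}
    (hnil : f [] = 0) (hcons : HasSum (fun p : ι × List ι => f (p.1 :: p.2)) x) : HasSum f x := by
  have hinj : Function.Injective fun p : ι × List ι => p.1 :: p.2 := fun p q h => by
    simpa [Prod.ext_iff] using h
  refine (hinj.hasSum_iff fun w hw => ?_).1 hcons
  cases w with
  | nil => exact hnil
  | cons s w => exact absurd ⟨(s, w), rfl⟩ hw

theorem hasSum_subtype_length {E : Type*} [NormedAddCommGroup E] {f : List ι → E} {x : E} {k : ℕ}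
    (h : HasSum (fun w => if w.length = k then f w else 0) x) :
    HasSum (fun w : {w : List ι // w.length = k} => f w) x :=
  ((Subtype.val_injective.hasSum_iff fun w hw => if_neg fun hk => hw ⟨⟨w, hk⟩, rfl⟩).2
    h).congr_fun fun w => (if_pos w.2).symm

theorem summable_of_hasSum_length {f : List ι → ℝ} {g : ℕ → ℝ} (hf : ∀ w, 0 ≤ f w)
    (h : ∀ k, HasSum (fun w => if w.length = k then f w else 0) (g k)) (hg : Summable g) :
    Summable f := by
  have hfiber (k : ℕ) := hasSum_subtype_length (h k)
  refine (Equiv.sigmaFiberEquiv List.length).summable_iff.1 ((summable_sigma_of_nonneg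
    fun _ => hf _).2 ⟨fun k => (hfiber k).summable, hg.congr fun k => (hfiber k).tsum_eq.symm⟩)

theorem hasSum_of_hasSum_length {E : Type*} [NormedAddCommGroup E] {f : List ι → E} {g : ℕ → E}
    {x : E} (hf : Summable f) (h : ∀ k, HasSum (fun w => if w.length = k then f w else 0) (g k))
    (hg : HasSum g x) : HasSum f x := by
  have hsigma := ((Equiv.sigmaFiberEquiv List.length).hasSum_iff.2 hf.hasSum).sigma
    fun k => hasSum_subtype_length (h k)
  exact hsigma.unique hg ▸ hf.hasSum

variable {C : ι → ℝ}

theorem prod_map_nonneg (hC : ∀ s, 0 ≤ C s) (w : List ι) : 0 ≤ (w.map C).prod :=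
  List.prod_nonneg (by simpa using fun s _ => hC s)

theorem hasSum_prod_map_length (hC : ∀ s, 0 ≤ C s) (hs : Summable C) (k : ℕ) :
    HasSum (fun w : List ι => if w.length = k then (w.map C).prod else 0) ((∑' s, C s) ^ k) := by
  induction k with
  | zero =>
    rw [pow_zero]
    refine (hasSum_ite_eq ([] : List ι) (1 : ℝ)).congr_fun fun w => ?_
    cases w <;> simp
  | succ k ih =>
    have hnonneg (w : List ι) : 0 ≤ if w.length = k then (w.map C).prod else 0 := by
      split_ifs
      exacts [prod_map_nonneg hC w, le_rfl]
    refine hasSum_list_of_hasSum_cons (by simp) ?_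
    rw [pow_succ']
    exact (hs.hasSum.mul ih (hs.mul_of_nonneg ih.summable hC hnonneg)).congr_fun fun p => by simp

theorem summable_prod_map_div_factorial (hC : ∀ s, 0 ≤ C s) (hs : Summable C) :
    Summable fun w : List ι => (w.map C).prod / w.length.factorial := by
  refine summable_of_hasSum_length (fun w => div_nonneg (prod_map_nonneg hC w) (by positivity))
    (fun k => ?_) (Real.summable_pow_div_factorial (∑' s, C s))
  refine ((hasSum_prod_map_length hC hs k).div_const _).congr_fun fun w => ?_
  split_ifs with hw
  · rw [hw]
  · rw [zero_div]

end Words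

theorem integral_deriv_mul_pow_div_factorial {Φ σ : ℝ → ℂ} {a b : ℝ}
    (hΦ : ∀ x ∈ Set.uIcc a b, HasDerivAt Φ (σ x) x) (hσ : ContinuousOn σ (Set.uIcc a b)) (k : ℕ) :
    ∫ x in a..b, σ x * (Φ x ^ k / k.factorial) =
      Φ b ^ (k + 1) / (k + 1).factorial - Φ a ^ (k + 1) / (k + 1).factorial := by
  refine intervalIntegral.integral_eq_sub_of_hasDerivAt
    (f := fun x => Φ x ^ (k + 1) / (k + 1).factorial) (fun x hx => ?_) ?_
  · refine (((hΦ x hx).fun_pow (k + 1)).div_const _).congr_deriv ?_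
    have hfactorial : (k.factorial : ℂ) ≠ 0 := by exact_mod_cast k.factorial_ne_zero
    have hsucc : (k : ℂ) + 1 ≠ 0 := by exact_mod_cast k.succ_ne_zero
    rw [Nat.factorial_succ, Nat.add_sub_cancel]
    push_cast
    field_simp
  · have hcont : ContinuousOn Φ (Set.uIcc a b) := fun x hx =>
      (hΦ x hx).continuousAt.continuousWithinAt
    exact (hσ.mul ((hcont.pow k).div_const _)).intervalIntegrable

section IteratedIntegral

variable {ι : Type*} {φ : ι → ℝ → ℂ} {C : ι → ℝ}

/-- The iterated integral `∫_0^t φ_{s₁}(x₁) ∫_0^{x₁} φ_{s₂}(x₂) ⋯` along the word `s₁ s₂ ⋯`. -/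
def iteratedIntegral (φ : ι → ℝ → ℂ) : List ι → ℝ → ℂ
  | [], _ => 1
  | s :: w, t => ∫ x in (0 : ℝ)..t, φ s x * iteratedIntegral φ w x

theorem continuousOn_iteratedIntegral (hφ : ∀ s, ContinuousOn (φ s) (Set.Icc 0 1)) (w : List ι) :
    ContinuousOn (iteratedIntegral φ w) (Set.Icc 0 1) := by
  induction w with
  | nil => exact continuousOn_const
  | cons s w ih =>
    have hintegrable := ((hφ s).mul ih).integrableOn_Icc (μ := MeasureTheory.volume)
    rw [← Set.uIcc_of_le zero_le_one] at hintegrable ⊢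
    exact intervalIntegral.continuousOn_primitive_interval hintegrable

theorem integral_pow_div_factorial (n : ℕ) (t : ℝ) :
    ∫ x in (0 : ℝ)..t, x ^ n / n.factorial = t ^ (n + 1) / (n + 1).factorial := by
  rw [intervalIntegral.integral_div, integral_pow, zero_pow n.succ_ne_zero, sub_zero,
    Nat.factorial_succ, div_div]
  push_cast
  rfl

theorem norm_iteratedIntegral_le_mul_pow (hle : ∀ s, ∀ x ∈ Set.Icc (0 : ℝ) 1, ‖φ s x‖ ≤ C s)
    (w : List ι) {t : ℝ} (ht : t ∈ Set.Icc (0 : ℝ) 1) :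
    ‖iteratedIntegral φ w t‖ ≤ (w.map C).prod * (t ^ w.length / w.length.factorial) := by
  induction w generalizing t with
  | nil => simp [iteratedIntegral]
  | cons s w ih =>
    rw [List.map_cons, List.prod_cons, List.length_cons, ← integral_pow_div_factorial,
      ← intervalIntegral.integral_const_mul]
    refine intervalIntegral.norm_integral_le_of_norm_le ht.1 (.of_forall fun x hx => ?_)
      (Continuous.intervalIntegrable (by fun_prop) _ _)
    have hx₁ : x ∈ Set.Icc (0 : ℝ) 1 := ⟨hx.1.le, hx.2.trans ht.2⟩
    rw [norm_mul, mul_assoc]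
    exact mul_le_mul (hle s x hx₁) (ih hx₁) (norm_nonneg _) ((norm_nonneg _).trans (hle s x hx₁))

theorem norm_iteratedIntegral_le (hle : ∀ s, ∀ x ∈ Set.Icc (0 : ℝ) 1, ‖φ s x‖ ≤ C s)
    (w : List ι) {t : ℝ} (ht : t ∈ Set.Icc (0 : ℝ) 1) :
    ‖iteratedIntegral φ w t‖ ≤ (w.map C).prod / w.length.factorial := by
  have hC (s : ι) : 0 ≤ C s := (norm_nonneg _).trans (hle s t ht)
  refine (norm_iteratedIntegral_le_mul_pow hle w ht).trans ?_
  rw [div_eq_mul_inv, div_eq_mul_inv]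
  refine mul_le_mul_of_nonneg_left ?_ (prod_map_nonneg hC w)
  exact mul_le_of_le_one_left (by positivity) (pow_le_one₀ ht.1 ht.2)

theorem summable_mul_prod_map_div_factorial (hC₀ : ∀ s, 0 ≤ C s) (hC : Summable C) :
    Summable fun p : ι × List ι => C p.1 * ((p.2.map C).prod / p.2.length.factorial) :=
  hC.mul_of_nonneg (summable_prod_map_div_factorial hC₀ hC) hC₀
    fun w => div_nonneg (prod_map_nonneg hC₀ w) (by positivity)

theorem norm_mul_iteratedIntegral_length_le (hle : ∀ s, ∀ x ∈ Set.Icc (0 : ℝ) 1, ‖φ s x‖ ≤ C s)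
    (k : ℕ) (p : ι × List ι) {x : ℝ} (hx : x ∈ Set.Icc (0 : ℝ) 1) :
    ‖φ p.1 x * if p.2.length = k then iteratedIntegral φ p.2 x else 0‖ ≤
      C p.1 * ((p.2.map C).prod / p.2.length.factorial) := by
  have hC₀ (s : ι) : 0 ≤ C s := (norm_nonneg _).trans (hle s x hx)
  rw [norm_mul]
  refine mul_le_mul (hle _ x hx) ?_ (norm_nonneg _) (hC₀ _)
  split_ifs
  · exact norm_iteratedIntegral_le hle p.2 hx
  · rw [norm_zero]
    exact div_nonneg (prod_map_nonneg hC₀ _) (by positivity)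

theorem continuousOn_mul_iteratedIntegral_length (hφ : ∀ s, ContinuousOn (φ s) (Set.Icc 0 1))
    (k : ℕ) (p : ι × List ι) :
    ContinuousOn (fun x => φ p.1 x * if p.2.length = k then iteratedIntegral φ p.2 x else 0)
      (Set.Icc 0 1) := by
  refine (hφ p.1).mul ?_
  split_ifs
  exacts [continuousOn_iteratedIntegral hφ p.2, continuousOn_const]

theorem hasSum_mul_iteratedIntegral_length (hC : Summable C)
    (hle : ∀ s, ∀ x ∈ Set.Icc (0 : ℝ) 1, ‖φ s x‖ ≤ C s) (k : ℕ) {x : ℝ}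
    (hx : x ∈ Set.Icc (0 : ℝ) 1) {a b : ℂ} (ha : HasSum (fun s => φ s x) a)
    (hb : HasSum (fun w => if w.length = k then iteratedIntegral φ w x else 0) b) :
    HasSum (fun p : ι × List ι =>
      φ p.1 x * if p.2.length = k then iteratedIntegral φ p.2 x else 0) (a * b) := by
  have hC₀ (s : ι) : 0 ≤ C s := (norm_nonneg _).trans (hle s x hx)
  have hsummable : Summable fun p : ι × List ι =>
      φ p.1 x * if p.2.length = k then iteratedIntegral φ p.2 x else 0 :=
    Summable.of_norm_bounded (summable_mul_prod_map_div_factorial hC₀ hC) fun p =>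
      norm_mul_iteratedIntegral_length_le hle k p hx
  simpa only using ha.mul hb hsummable

theorem hasSum_integral_iteratedIntegral_length [Countable ι] {g : ℝ → ℂ}
    (hφ : ∀ s, ContinuousOn (φ s) (Set.Icc 0 1)) (hC : Summable C)
    (hle : ∀ s, ∀ x ∈ Set.Icc (0 : ℝ) 1, ‖φ s x‖ ≤ C s) {σ : ℝ → ℂ}
    (hσ : ∀ x ∈ Set.Icc (0 : ℝ) 1, HasSum (fun s => φ s x) (σ x)) {k : ℕ}
    (hg : ∀ x ∈ Set.Icc (0 : ℝ) 1,
      HasSum (fun w => if w.length = k then iteratedIntegral φ w x else 0) (g x))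
    {t : ℝ} (ht : t ∈ Set.Icc (0 : ℝ) 1) :
    HasSum (fun w => if w.length = k + 1 then iteratedIntegral φ w t else 0)
      (∫ x in (0 : ℝ)..t, σ x * g x) := by
  have hC₀ (s : ι) : 0 ≤ C s := (norm_nonneg _).trans (hle s t ht)
  have hbound := summable_mul_prod_map_div_factorial hC₀ hC
  have hsub : Set.uIoc 0 t ⊆ Set.Icc 0 1 := by
    rw [Set.uIoc_of_le ht.1]
    exact Set.Ioc_subset_Icc_self.trans (Set.Icc_subset_Icc_right ht.2)
  have hmain := intervalIntegral.hasSum_integral_of_dominated_convergence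
    (μ := MeasureTheory.volume) (a := 0) (b := t) (f := fun x => σ x * g x)
    (F := fun (p : ι × List ι) x =>
      φ p.1 x * if p.2.length = k then iteratedIntegral φ p.2 x else 0)
    (fun p _ => C p.1 * ((p.2.map C).prod / p.2.length.factorial))
    (fun p => ((continuousOn_mul_iteratedIntegral_length hφ k p).mono hsub).aestronglyMeasurable
      measurableSet_uIoc)
    (fun p => .of_forall fun x hx => norm_mul_iteratedIntegral_length_le hle k p (hsub hx))
    (.of_forall fun _ _ => hbound) (by simp)
    (.of_forall fun x hx => hasSum_mul_iteratedIntegral_length hC hle k (hsub hx)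
      (hσ x (hsub hx)) (hg x (hsub hx)))
  refine hasSum_list_of_hasSum_cons (by simp) (hmain.congr_fun fun p => ?_)
  by_cases hp : p.2.length = k <;> simp [hp, iteratedIntegral]

theorem hasSum_iteratedIntegral_length [Countable ι] {Φ σ : ℝ → ℂ}
    (hφ : ∀ s, ContinuousOn (φ s) (Set.Icc 0 1)) (hC : Summable C)
    (hle : ∀ s, ∀ x ∈ Set.Icc (0 : ℝ) 1, ‖φ s x‖ ≤ C s)
    (hσ : ∀ x ∈ Set.Icc (0 : ℝ) 1, HasSum (fun s => φ s x) (σ x))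
    (hΦ : ∀ x ∈ Set.Icc (0 : ℝ) 1, HasDerivAt Φ (σ x) x) (hΦ₀ : Φ 0 = 0) (k : ℕ) {t : ℝ}
    (ht : t ∈ Set.Icc (0 : ℝ) 1) :
    HasSum (fun w => if w.length = k then iteratedIntegral φ w t else 0)
      (Φ t ^ k / k.factorial) := by
  induction k generalizing t with
  | zero =>
    rw [pow_zero, Nat.factorial_zero, Nat.cast_one, div_one]
    refine (hasSum_ite_eq ([] : List ι) (1 : ℂ)).congr_fun fun w => ?_
    cases w <;> simp [iteratedIntegral]
  | succ k ih =>
    have hsub : Set.uIcc 0 t ⊆ Set.Icc 0 1 := by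
      rw [Set.uIcc_of_le ht.1]
      exact Set.Icc_subset_Icc_right ht.2
    have hcont : ContinuousOn σ (Set.Icc 0 1) :=
      (continuousOn_tsum hφ hC hle).congr fun x hx => (hσ x hx).tsum_eq.symm
    have hsum := hasSum_integral_iteratedIntegral_length hφ hC hle hσ (fun _ => ih) ht
    rwa [integral_deriv_mul_pow_div_factorial (fun x hx => hΦ x (hsub hx)) (hcont.mono hsub),
      hΦ₀, zero_pow k.succ_ne_zero, zero_div, sub_zero] at hsum

theorem hasSum_iteratedIntegral [Countable ι] {Φ σ : ℝ → ℂ}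
    (hφ : ∀ s, ContinuousOn (φ s) (Set.Icc 0 1)) (hC : Summable C)
    (hle : ∀ s, ∀ x ∈ Set.Icc (0 : ℝ) 1, ‖φ s x‖ ≤ C s)
    (hσ : ∀ x ∈ Set.Icc (0 : ℝ) 1, HasSum (fun s => φ s x) (σ x))
    (hΦ : ∀ x ∈ Set.Icc (0 : ℝ) 1, HasDerivAt Φ (σ x) x) (hΦ₀ : Φ 0 = 0) {t : ℝ}
    (ht : t ∈ Set.Icc (0 : ℝ) 1) :
    HasSum (fun w => iteratedIntegral φ w t) (Complex.exp (Φ t)) := by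
  have hC₀ (s : ι) : 0 ≤ C s := (norm_nonneg _).trans (hle s t ht)
  refine hasSum_of_hasSum_length ?_ (hasSum_iteratedIntegral_length hφ hC hle hσ hΦ hΦ₀ · ht) ?_
  · exact .of_norm_bounded (summable_prod_map_div_factorial hC₀ hC)
      fun w => norm_iteratedIntegral_le hle w ht
  · rw [Complex.exp_eq_exp_ℂ]
    exact NormedSpace.expSeries_div_hasSum_exp (Φ t)

end IteratedIntegral

section Path

variable {z : ℂ}

/-- The differential form `ω_s`, pulled back to `[0, 1]` along the segment from `0` to `z`. -/
def pathForm (z : ℂ) (s : ℕ+) (x : ℝ) : ℂ := deriv (ell s) (x * z) * z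

theorem norm_ofReal_mul_le {x : ℝ} (hx : x ∈ Set.Icc (0 : ℝ) 1) (z : ℂ) : ‖(x : ℂ) * z‖ ≤ ‖z‖ := by
  rw [norm_mul, Complex.norm_real, Real.norm_of_nonneg hx.1]
  exact mul_le_of_le_one_left (norm_nonneg z) hx.2

theorem alphaWord_ofReal_mul (w : Word) (z : ℂ) (t : ℝ) :
    alphaWord w (t * z) = iteratedIntegral (pathForm z) w t := by
  induction w generalizing t with
  | nil => rfl
  | cons s w ih =>
    have hsubst := intervalIntegral.smul_integral_comp_mul_right (a := 0) (b := 1)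
      (fun x => pathForm z s x * iteratedIntegral (pathForm z) w x) t
    rw [zero_mul, one_mul] at hsubst
    rw [alphaWord, iteratedIntegral, ← hsubst, ← intervalIntegral.integral_smul]
    refine intervalIntegral.integral_congr fun x _ => ?_
    simp only [← mul_assoc (x : ℂ), ← Complex.ofReal_mul, ih, pathForm, Complex.real_smul]
    ring

theorem continuousOn_pathForm (hz : ‖z‖ < 1) (s : ℕ+) :
    ContinuousOn (pathForm z s) (Set.Icc 0 1) := by
  have hderiv := ((differentiableOn_ell s).deriv Metric.isOpen_ball).continuousOn
  have hpath : Continuous fun x : ℝ => (x : ℂ) * z := by fun_prop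
  exact (hderiv.comp hpath.continuousOn fun x hx =>
    mem_ball_zero_iff.2 ((norm_ofReal_mul_le hx z).trans_lt hz)).mul continuousOn_const

theorem norm_deriv_le_div_of_norm_le {f : ℂ → ℂ} {B r ρ : ℝ} {u : ℂ}
    (hf : DifferentiableOn ℂ f (Metric.ball 0 1)) (hρ : ρ < 1) (hle : ∀ v, ‖v‖ ≤ ρ → ‖f v‖ ≤ B)
    (hu : ‖u‖ ≤ r) (hr : r < ρ) : ‖deriv f u‖ ≤ B / (ρ - r) := by
  have hsub : ∀ v ∈ Metric.closedBall u (ρ - r), ‖v‖ ≤ ρ := fun v hv => by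
    linarith [norm_le_norm_add_norm_sub' v u, mem_closedBall_iff_norm.1 hv]
  have hdiff : DiffContOnCl ℂ f (Metric.ball u (ρ - r)) :=
    (hf.mono fun v hv => mem_ball_zero_iff.2
      ((hsub v (Metric.closure_ball_subset_closedBall hv)).trans_lt hρ)).diffContOnCl
  exact Complex.norm_deriv_le_of_forall_mem_sphere_norm_le (sub_pos.2 hr) hdiff fun v hv =>
    hle v (hsub v (Metric.sphere_subset_closedBall hv))

theorem norm_pathForm_le {ρ : ℝ} (hzρ : ‖z‖ < ρ) (hρ : ρ < 1) (s : ℕ+) {x : ℝ}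
    (hx : x ∈ Set.Icc (0 : ℝ) 1) :
    ‖pathForm z s x‖ ≤ ellBound ρ / (ρ - ‖z‖) * ρ ^ (s : ℕ) := by
  rw [pathForm, norm_mul, div_mul_eq_mul_div]
  exact (mul_le_of_le_one_right (norm_nonneg _) (hzρ.trans hρ).le).trans
    (norm_deriv_le_div_of_norm_le (differentiableOn_ell s) hρ (fun _ => norm_ell_le hρ s)
      (norm_ofReal_mul_le hx z) hzρ)

theorem hasDerivAt_ellSum_ofReal_mul (hz : ‖z‖ < 1) {x : ℝ} (hx : x ∈ Set.Icc (0 : ℝ) 1) :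
    HasDerivAt (fun x : ℝ => ellSum (x * z)) (deriv ellSum (x * z) * z) x := by
  have hmem : (x : ℂ) * z ∈ Metric.ball (0 : ℂ) 1 :=
    mem_ball_zero_iff.2 ((norm_ofReal_mul_le hx z).trans_lt hz)
  have hdiff := differentiableOn_ellSum.differentiableAt (Metric.isOpen_ball.mem_nhds hmem)
  exact (hdiff.hasDerivAt.comp (x : ℂ) (hasDerivAt_mul_const z)).comp_ofReal

theorem hasSum_alphaWord (hz : ‖z‖ < 1) :
    HasSum (fun w => alphaWord w z) (Complex.exp (ellSum z)) := by
  obtain ⟨ρ, hzρ, hρ⟩ := exists_between hz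
  have hsummable := (summable_pow_pnat ((norm_nonneg z).trans hzρ.le) hρ).mul_left
    (ellBound ρ / (ρ - ‖z‖))
  have hsum := hasSum_iteratedIntegral (continuousOn_pathForm hz) hsummable
    (fun s _ hx => norm_pathForm_le hzρ hρ s hx)
    (fun x hx => (hasSum_deriv_ell ((norm_ofReal_mul_le hx z).trans_lt hz)).mul_right z)
    (fun x hx => hasDerivAt_ellSum_ofReal_mul hz hx) (by simp [ellSum_zero])
    (Set.right_mem_Icc.2 zero_le_one)
  simpa only [← alphaWord_ofReal_mul, Complex.ofReal_one, one_mul] using hsum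

end Path

theorem hasProd_exp_ell {z : ℂ} (hz : ‖z‖ < 1) :
    HasProd (fun r => Complex.exp (ell r z)) (Complex.exp (ellSum z)) :=
  (hasSum_ell hz).cexp

theorem gammaSeries_starLaw_of_summable {a b : ℕ+ → ℂ} (ha : Summable fun s => ‖a s‖)
    (hb : Summable fun s => ‖b s‖) :
    kleeneStar (letters a) ∈ gammaDom ∧ kleeneStar (letters b) ∈ gammaDom ∧
      kleeneStar (letters (starLaw a b)) ∈ gammaDom ∧
      gammaSeries (kleeneStar (letters (starLaw a b))) =
        gammaSeries (kleeneStar (letters a)) * gammaSeries (kleeneStar (letters b)) := by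
  have ha_mem := kleeneStar_mem_gammaDom (absSummable_gammaGen ha)
  have hb_mem := kleeneStar_mem_gammaDom (absSummable_gammaGen hb)
  have hab_mem := kleeneStar_mem_gammaDom (absSummable_gammaGen (summable_norm_starLaw ha hb))
  exact ⟨ha_mem, hb_mem, hab_mem, gammaSeries_starLaw ha_mem hb_mem hab_mem⟩

end EulerianStars

end

theorem mainTheorem10 :
    (∀ w : Word, HasFinitePart (harmonicSum w) (gammaWord w)) ∧
    (∀ z : ℂ, ‖z‖ < 1 →
      (∀ r : ℕ+, kleeneStar (letters (Pi.single r (z ^ (r : ℕ)))) ∈ gammaDom) ∧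
      ∃ S T : Series,
        IsInfiniteProduct stuffle (fun r => kleeneStar (letters (Pi.single r (z ^ (r : ℕ))))) S ∧
        IsInfiniteProduct shuffle (fun r => kleeneStar (letters (Pi.single r 1))) T ∧
        S ∈ gammaDom ∧
        HasProd (fun r : ℕ+ => gammaSeries (kleeneStar (letters (Pi.single r (z ^ (r : ℕ))))))
          (gammaSeries S) ∧
        HasProd (fun r : ℕ+ => Complex.exp (ell r z)) (gammaSeries S) ∧
        HasProd (fun r : ℕ+ => 1 / GammaY r (1 + z)) (gammaSeries S) ∧
        HasSum (fun w : Word => T w * alphaWord w z) (gammaSeries S)) ∧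
    (∀ a b : ℕ+ → ℂ, Summable (fun s => ‖a s‖) → Summable (fun s => ‖b s‖) →
      kleeneStar (letters a) ∈ gammaDom ∧ kleeneStar (letters b) ∈ gammaDom ∧
      kleeneStar (letters (starLaw a b)) ∈ gammaDom ∧
      gammaSeries (kleeneStar (letters (starLaw a b))) =
        gammaSeries (kleeneStar (letters a)) * gammaSeries (kleeneStar (letters b))) ∧
    (∀ a b : ℕ+ → ℂ, kleeneStar (letters a) ∈ gammaDom → kleeneStar (letters b) ∈ gammaDom →
      kleeneStar (letters (starLaw a b)) ∈ gammaDom →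
      gammaSeries (kleeneStar (letters (starLaw a b))) =
        gammaSeries (kleeneStar (letters a)) * gammaSeries (kleeneStar (letters b))) ∧
    (∀ (r s : ℕ+) (c d : ℂ),
      kleeneStar (letters (Pi.single s c + Pi.single r d + Pi.single (s + r) (c * d))) ∈ gammaDom ∧
      kleeneStar (letters (Pi.single s c)) ∈ gammaDom ∧ kleeneStar (letters (Pi.single r d)) ∈ gammaDom ∧
      gammaSeries
          (kleeneStar (letters (Pi.single s c + Pi.single r d + Pi.single (s + r) (c * d)))) =
        gammaSeries (kleeneStar (letters (Pi.single s c))) *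
          gammaSeries (kleeneStar (letters (Pi.single r d)))) ∧
    (∀ (s : ℕ+) (c : ℂ),
      kleeneStar (letters (Pi.single (2 * s) (-c ^ 2))) ∈ gammaDom ∧
      kleeneStar (letters (Pi.single s c)) ∈ gammaDom ∧ kleeneStar (letters (Pi.single s (-c))) ∈ gammaDom ∧
      gammaSeries (kleeneStar (letters (Pi.single (2 * s) (-c ^ 2)))) =
        gammaSeries (kleeneStar (letters (Pi.single s c))) *
          gammaSeries (kleeneStar (letters (Pi.single s (-c))))) := by
  refine ⟨hasFinitePart_gammaWord, fun z hz => ⟨fun r => ?_, _, _,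
    isInfiniteProduct_stuffle_kleeneStar _, isInfiniteProduct_shuffle_kleeneStar _,
    kleeneStar_mem_gammaDom (absSummable_gammaGen_starLawLim_pow hz), ?_⟩,
    fun _ _ => gammaSeries_starLaw_of_summable, fun _ _ => gammaSeries_starLaw,
    fun r s c d => ?_, fun s c => ?_⟩
  · exact kleeneStar_mem_gammaDom (absSummable_gammaGen (summable_norm_single _ _))
  · rw [gammaSeries_starLawLim_pow hz]
    refine ⟨?_, hasProd_exp_ell hz, ?_, ?_⟩
    · simpa only [gammaSeries_single _ hz] using hasProd_exp_ell hz
    · simpa only [GammaY, add_sub_cancel_left, one_div, Complex.exp_neg, inv_inv] using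
        hasProd_exp_ell hz
    · simpa [kleeneStar_letters] using hasSum_alphaWord hz
  · obtain ⟨hs, hr, hsr, hmul⟩ := gammaSeries_starLaw_of_summable
      (summable_norm_single s c) (summable_norm_single r d)
    rw [starLaw_single] at hsr hmul
    exact ⟨hsr, hs, hr, hmul⟩
  · obtain ⟨hc, hneg, hsq, hmul⟩ := gammaSeries_starLaw_of_summable
      (summable_norm_single s c) (summable_norm_single s (-c))
    rw [starLaw_single_neg] at hsq hmul
    exact ⟨hsq, hc, hneg, hmul⟩
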